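/- **Setting.** For $q\in\mathbb C\setminus\{0\}$ write $[n]_q=\frac{q^n-q^{-n}}{q-q^{-1}}=\sum_{k=0}^{n-1}q^{n-1-2k}$. Let $N\ge 1$ be an integer, $q\in\mathbb C\setminus\{0\}$ and $r\in\mathbb R\setminus\{0\}$ such that $[k]_q\neq 0$ for $1\le k\le N+2$, $[2]_{q^2}\ne0$ and $[2]_{q^{N+1}}\neq 0$ (this holds for every real $q\ne0$, and for all but finitely many $q=e^{i\pi\varphi}$ with $|\varphi|<\frac1{2N}$). All square roots are principal ones, $q^{m/2}=(\sqrt q)^m$, and repeated indices, which run over $1,0,-1$, are summed. *Tensors.* $g^{1,-1}=-q$, $g^{00}=1$, $g^{-1,1}=-q^{-1}$, $g_{ij}=g^{ij}$, other entries $0$; $\varepsilon^{ij}_k=\varepsilon_{ij}^k=\varepsilon^k_{ij}=\varepsilon_k^{ij}$ with $\varepsilon^{10}_1=q$, $\varepsilon^{01}_1=-q^{-1}$, $\varepsilon^{1,-1}_0=1$, $\varepsilon^{00}_0=q-q^{-1}$, $\varepsilon^{-1,1}_0=-1$, $\varepsilon^{0,-1}_{-1}=q$, $\varepsilon^{-1,0}_{-1}=-q^{-1}$,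 other entries $0$; $\varepsilon^{ijk}=g^{in}\varepsilon^{jk}_n$. Further $$\hat R^{kl}_{ij}=q^2(P^+)^{kl}_{ij}-q^{-2}(P^-)^{kl}_{ij}+q^{-4}(P^0)^{kl}_{ij},$$ where $(P^0)^{kl}_{ij}=\frac1{[3]_q}g^{kl}g_{ij}$, $(P^-)^{kl}_{ij}=\frac1{[2]_{q^2}}\varepsilon^{kl}_n\varepsilon^n_{ij}$, $P^+=1-P^--P^0$. *Functions.* Let $F_N$ be the spin $N/2$ representation of $U_q(su(2))$, with basis $e_0,\dots,e_N$ and $He_k=(N-2k)e_k$, $X^+e_k=[k]_qe_{k-1}$, $X^-e_k=[N-k]_qe_{k+1}$. The algebra of functions on the $q$-deformed fuzzy sphere is $\mathcal S^2_{q,N}=\operatorname{End}(F_N)=\mathrm{Mat}(N+1,\mathbb C)$. Put $\Lambda_N=r\frac{[2]_{q^{N+1}}}{\sqrt{[N]_q[N+2]_q}}$, and, with $\rho=\frac r{\sqrt{[N]_q[N+2]_q}}$, $$x_1=\rho\sqrt{[2]_q}\,q\,X^+q^{H/2},\quad x_0=\rho\,(qX^-X^+-q^{-1}X^+X^-),\quad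 x_{-1}=-\rho\sqrt{[2]_q}\,q^{-1}X^-q^{H/2},$$ the spin 1 coordinates, which generate $\mathcal S^2_{q,N}$ and satisfy $\varepsilon^{ij}_kx_ix_j=\Lambda_Nx_k$ and $g^{ij}x_ix_j=r^2$. *Forms.* $\Omega^*$ is the unital algebra generated by $\mathcal S^2_{q,N}$ (as a subalgebra) and $\xi_1,\xi_0,\xi_{-1}$ with the relations $$x_i\xi_j=\hat R^{kl}_{ij}\,\xi_kx_l,\qquad \xi_i\xi_j=-q^2\hat R^{kl}_{ij}\,\xi_k\xi_l .$$ Let $\Omega^1$ be the span of all $\xi_if$ with $f\in\mathcal S^2_{q,N}$ (a bimodule over $\mathcal S^2_{q,N}$), and $\Theta=x_i\xi_jg^{ij}$. The Hodge star on one-forms is the (well-defined) right module map $\ast_H$ on $\Omega^1$ with $\ast_H(\xi_i)=-\frac{q^{-2}\Lambda_N}{[2]_{q^2}}\varepsilon_i^{jk}\xi_j\xi_k$. The exterior derivative is $df=[\Theta,f]$ for $f\in\mathcal S^2_{q,N}$ and $d\alpha=\Theta\alpha+\alpha\Theta-\ast_H\alpha$ for $\alpha\in\Omega^1$. *The frame.*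 Let $\mathcal R=\mathcal R_1\otimes\mathcal R_2=q^{\frac12H\otimes H}\sum_n q^{n(n-1)/2}\frac{(q-q^{-1})^n}{[n]_q!}(X^+q^{H/2})^n\otimes(q^{-H/2}X^-)^n$ be the universal $R$-matrix and $\pi$ the spin 1 representation in the weight basis with indices $1,0,-1$, where the only non-zero entries of $\pi(X^-)$ are $\pi^0_1(X^-)=\pi^{-1}_0(X^-)=\sqrt{[2]_q}$. Put ${L^+}^i_j=\mathcal R_1\pi^i_j(\mathcal R_2)$ and $S({L^+}^i_j)=\mathcal R^{-1}_1\pi^i_j(\mathcal R^{-1}_2)$, acting on $F_N$, hence elements of $\mathcal S^2_{q,N}$ (so that ${L^+}^i_kS({L^+}^k_j)=\delta^i_j$). Define $$\theta^a=\Lambda_N\,S({L^+}^a_j)\,g^{jk}\xi_k\in\Omega^1,\qquad \lambda_a=\frac1{\Lambda_N}\,x_i\,{L^+}^i_a\in\mathcal S^2_{q,N}.$$ **Statement.** The $\theta^a$ are a basis of $\Omega^1$ as a left $\mathcal S^2_{q,N}$-module, and for all $f\in\mathcal S^2_{q,N}$ and all indices $a,b,c$ $$[\theta^a,f]=0,\qquad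 df=[\lambda_a,f]\,\theta^a,\qquad \Theta=\lambda_a\theta^a,$$ $$\lambda_a\lambda_b\,g^{ba}=\frac{r^2}{q^4\Lambda_N^2},\qquad \lambda_a\lambda_b\,\varepsilon^{ba}_c=-\frac1{q^2}\lambda_c,$$ $$\theta^a\theta^b=-q^2\,\hat R^{ba}_{cd}\,\theta^d\theta^c,$$ $$d\theta^a=\lambda_b(\theta^a\theta^b+\theta^b\theta^a)+\frac1{q^2[2]_{q^2}}\,\varepsilon^a_{bc}\,\theta^c\theta^b,$$ $$\ast_H\theta^a=-\frac1{q^2[2]_{q^2}}\,\varepsilon^a_{bc}\,\theta^c\theta^b,\qquad \theta^a\theta^b\theta^c=-\Lambda_N^2\frac{q^6}{r^2}\,\varepsilon^{cba}\,\Theta^3 .$$ -/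

import Mathlib

open scoped Matrix

noncomputable section

namespace QFuzzySphere

/-- A square root of a complex number (principal branch; the positive one for positive reals). -/
def csqrt (z : ℂ) : ℂ := z ^ (1 / 2 : ℂ)

theorem csqrt_sq (z : ℂ) : csqrt z ^ 2 = z := by
  rw [csqrt, ← Complex.cpow_nat_mul]; norm_num

/-- The `q`-number `[n]_q = (q ^ n - q ^ (-n)) / (q - q⁻¹) = ∑_{k < n} q ^ (n - 1 - 2 k)`
(the sum also makes sense for `q = ± 1`). -/
def qnum (q : ℂ) (n : ℕ) : ℂ := ∑ k ∈ Finset.range n, q ^ ((n : ℤ) - 1 - 2 * k)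

/-- The `q`-factorial. -/
def qfact (q : ℂ) (n : ℕ) : ℂ := ∏ k ∈ Finset.range n, qnum q (k + 1)

/-- The parameters of the `q`-deformed fuzzy sphere: the deformation parameter `q`, the radius `r`
and the level `N`. Nothing is required but that the expressions by which the sphere, its calculus
and its frame are defined have non-zero denominators. -/
structure Params where
  N : ℕ
  q : ℂ
  r : ℝ
  one_le : 1 ≤ N
  q_ne : q ≠ 0
  r_ne : r ≠ 0
  qnum_ne : ∀ k, 1 ≤ k → k ≤ N + 2 → qnum q k ≠ 0
  two_sq_ne : qnum (q ^ 2) 2 ≠ 0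
  two_pow_ne : qnum (q ^ (N + 1)) 2 ≠ 0

/-! ### Invariant tensors of spin 1

The indices `1, 0, -1` of the weight basis of spin 1 are the elements `0, 1, 2` of `Fin 3`. -/

/-- Half the `H`-weight of the basis vector with index `i`. -/
def wt : Fin 3 → ℤ := ![1, 0, -1]

/-- The invariant metric `g^{ij} = g_{ij}`. -/
def g (q : ℂ) : Matrix (Fin 3) (Fin 3) ℂ := !![0, 0, -q; 0, 1, 0; -q⁻¹, 0, 0]

/-- The `q`-deformed structure constants: `eps q i j k` is `ε^{ij}_k = ε_{ij}^k`. -/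
def eps (q : ℂ) (i j k : Fin 3) : ℂ :=
  (![!![0, q, 0; -q⁻¹, 0, 0; 0, 0, 0],
     !![0, 0, 1; 0, q - q⁻¹, 0; -1, 0, 0],
     !![0, 0, 0; 0, 0, q; 0, -q⁻¹, 0]] : Fin 3 → Matrix (Fin 3) (Fin 3) ℂ) k i j

/-- The `q`-antisymmetric tensor `ε^{ijk} = g^{in} ε^{jk}_n`. -/
def epsUp (q : ℂ) (i j k : Fin 3) : ℂ := ∑ n, g q i n * eps q j k n

/-- The projector `(P⁰)^{kl}_{ij}`. -/
def projZero (q : ℂ) (k l i j : Fin 3) : ℂ := (qnum q 3)⁻¹ * (g q k l * g q i j)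

/-- The projector `(P⁻)^{kl}_{ij}`. -/
def projMinus (q : ℂ) (k l i j : Fin 3) : ℂ :=
  (qnum (q ^ 2) 2)⁻¹ * ∑ n, eps q k l n * eps q i j n

/-- The projector `(P⁺)^{kl}_{ij}`. -/
def projPlus (q : ℂ) (k l i j : Fin 3) : ℂ :=
  (if k = i ∧ l = j then 1 else 0) - projMinus q k l i j - projZero q k l i j

/-- The matrix `R̂^{kl}_{ij}` of `U_q(su(2))` on the tensor square of the spin 1 representation. -/
def Rhat (q : ℂ) (k l i j : Fin 3) : ℂ :=
  q ^ 2 * projPlus q k l i j - (q ^ 2)⁻¹ * projMinus q k l i j + (q ^ 4)⁻¹ * projZero q k l i j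

namespace Params

variable (P : Params)

/-! ### The algebra of functions -/

/-- The algebra `Mat(N + 1)` of operators on the spin `N / 2` representation `F_N`. -/
abbrev Fun : Type := Matrix (Fin (P.N + 1)) (Fin (P.N + 1)) ℂ

/-- `q ^ (m H / 2)` on `F_N`; the weight vectors are `e_0, …, e_N` with `H e_k = (N - 2 k) e_k`. -/
def qH (m : ℤ) : P.Fun := Matrix.diagonal fun k => csqrt P.q ^ (m * ((P.N : ℤ) - 2 * (k : ℕ)))

/-- The raising operator, `X⁺ e_k = [k] e_{k-1}`. -/
def Xp : P.Fun := Matrix.of fun i j => if (i : ℕ) + 1 = j then qnum P.q j else 0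

/-- The lowering operator, `X⁻ e_k = [N - k] e_{k+1}`. -/
def Xm : P.Fun := Matrix.of fun i j => if (i : ℕ) = j + 1 then qnum P.q (P.N - j) else 0

/-- `√([N] [N + 2])`. -/
def rootN : ℂ := csqrt (qnum P.q P.N * qnum P.q (P.N + 2))

/-- The constant `Λ_N = r [2]_{q ^ (N + 1)} / √([N] [N + 2])`. -/
def Lam : ℂ := P.r * qnum (P.q ^ (P.N + 1)) 2 / P.rootN

/-- The coordinate functions `x_1, x_0, x_{-1}`: the spin 1 multiplet of operators on `F_N`,
normalized by `g^{ij} x_i x_j = r²`. -/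
def x : Fin 3 → P.Fun :=
  ![(P.r / P.rootN * csqrt (qnum P.q 2) * P.q) • (P.Xp * P.qH 1),
    (P.r / P.rootN : ℂ) • (P.q • (P.Xm * P.Xp) - P.q⁻¹ • (P.Xp * P.Xm)),
    -(P.r / P.rootN * csqrt (qnum P.q 2) * P.q⁻¹) • (P.Xm * P.qH 1)]

theorem csqrt_ne {z : ℂ} (h : z ≠ 0) : csqrt z ≠ 0 := fun h0 => h (by rw [← csqrt_sq z, h0]; simp)

theorem root_ne : csqrt P.q ≠ 0 := csqrt_ne P.q_ne

theorem qnum_succ {q : ℂ} (hq : q ≠ 0) (n : ℕ) : qnum q (n + 1) = q * qnum q n + (q ^ n)⁻¹ := by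
  rw [qnum, Finset.sum_range_succ, qnum, Finset.mul_sum]
  congr 1
  · refine Finset.sum_congr rfl fun k _ => ?_
    rw [← zpow_one_add₀ hq]; congr 1; push_cast; ring
  · rw [← zpow_natCast, ← zpow_neg]; congr 1; push_cast; ring

theorem qnum_lam {q : ℂ} (hq : q ≠ 0) (n : ℕ) : (q - q⁻¹) * qnum q n = q ^ n - (q ^ n)⁻¹ := by
  induction n with
  | zero => simp [qnum]
  | succ n ih =>
    rw [qnum_succ hq, mul_add, ← mul_assoc, mul_comm _ q, mul_assoc, ih]
    field_simp; ring

theorem qnum_add {q : ℂ} (hq : q ≠ 0) (m n : ℕ) :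
    qnum q (m + n) = q ^ n * qnum q m + (q ^ m)⁻¹ * qnum q n := by
  induction n with
  | zero => simp [qnum]
  | succ n ih =>
    rw [← add_assoc, qnum_succ hq, ih, qnum_succ hq]
    field_simp; ring

theorem qnum_two {q : ℂ} (hq : q ≠ 0) : qnum q 2 = q + q⁻¹ := by
  rw [qnum_succ hq, qnum_succ hq]; simp [qnum]

theorem Xp_mul_apply (M : P.Fun) (i j : Fin (P.N + 1)) :
    (P.Xp * M) i j = if h : (i : ℕ) + 1 < P.N + 1 then qnum P.q (i + 1) * M ⟨i + 1, h⟩ j else 0 := by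
  rw [Matrix.mul_apply]
  split_ifs with h
  · rw [Finset.sum_eq_single ⟨i + 1, h⟩]
    · simp [Xp]
    · intro b _ hb
      have : (i : ℕ) + 1 ≠ b := fun e => hb (Fin.ext e.symm)
      simp [Xp, this]
    · simp
  · refine Finset.sum_eq_zero fun b _ => ?_
    have : (i : ℕ) + 1 ≠ b := by have := b.2; omega
    simp [Xp, this]

theorem Xm_mul_apply (M : P.Fun) (i j : Fin (P.N + 1)) :
    (P.Xm * M) i j = if h : 1 ≤ (i : ℕ) then
      qnum P.q (P.N + 1 - i) * M ⟨i - 1, by omega⟩ j else 0 := by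
  rw [Matrix.mul_apply]
  split_ifs with h
  · rw [Finset.sum_eq_single ⟨i - 1, by omega⟩]
    · have e : (i : ℕ) = i - 1 + 1 := by omega
      simp [Xm, ← e]
      left; congr 1; omega
    · intro b _ hb
      have : (i : ℕ) ≠ b + 1 := fun e => hb (Fin.ext (by simp; omega))
      simp [Xm, this]
    · simp
  · refine Finset.sum_eq_zero fun b _ => ?_
    have : (i : ℕ) ≠ b + 1 := by omega
    simp [Xm, this]

theorem qH_mul_apply (m : ℤ) (M : P.Fun) (i j : Fin (P.N + 1)) :
    (P.qH m * M) i j = csqrt P.q ^ (m * ((P.N : ℤ) - 2 * (i : ℕ))) * M i j := by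
  rw [qH, Matrix.diagonal_mul]

theorem root_zpow (n : ℤ) : csqrt P.q ^ (2 * n) = P.q ^ n := by
  rw [zpow_mul]; congr 1; exact_mod_cast csqrt_sq P.q

/-- Diagonal entries of `q X⁻ X⁺ - q⁻¹ X⁺ X⁻`. -/
def dl (k : ℕ) : ℂ :=
  P.q * (qnum P.q k * qnum P.q (P.N + 1 - k)) - P.q⁻¹ * (qnum P.q (k + 1) * qnum P.q (P.N - k))

theorem x_one : P.x 1 = (P.r / P.rootN : ℂ) • Matrix.diagonal fun k : Fin (P.N + 1) => P.dl k := by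
  have h : P.q • (P.Xm * P.Xp) - P.q⁻¹ • (P.Xp * P.Xm) = Matrix.diagonal fun k : Fin (P.N + 1) => P.dl k := by
    ext i j
    simp only [Matrix.sub_apply, Matrix.smul_apply, Xp_mul_apply, Xm_mul_apply, smul_eq_mul]
    by_cases hij : i = j
    · subst hij
      rw [Matrix.diagonal_apply_eq]
      have hi := i.2
      by_cases h1 : 1 ≤ (i : ℕ) <;> by_cases h2 : (i : ℕ) + 1 < P.N + 1
      · have : (i : ℕ) - 1 + 1 = i := by omega
        simp [h1, h2, Xp, Xm, this, dl, mul_comm]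
      · have : (i : ℕ) - 1 + 1 = i := by omega
        have h3 : P.N - i = 0 := by omega
        simp [h1, h2, Xp, this, dl, h3, qnum, mul_comm]
      · have h3 : (i : ℕ) = 0 := by omega
        have h5 : 0 < P.N := P.one_le
        have h6 : i = 0 := Fin.ext h3
        subst h6
        simp [Xm, dl, qnum, h5]
      · have h3 : (i : ℕ) = 0 := by omega
        have h4 := P.one_le
        omega
    · rw [Matrix.diagonal_apply_ne _ hij]
      have hij' : (i : ℕ) ≠ j := fun e => hij (Fin.ext e)
      split_ifs with h1 h2 h2
      · have : (i : ℕ) - 1 + 1 ≠ j := by omega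
        simp [Xp, Xm, this, hij']
      · have : (i : ℕ) - 1 + 1 ≠ j := by omega
        simp [Xp, this]
      · simp [Xm, hij']
      · simp
  rw [← h]; rfl

theorem x_zero_apply (i j : Fin (P.N + 1)) : P.x 0 i j = if (i : ℕ) + 1 = j then
    P.r / P.rootN * csqrt (qnum P.q 2) * P.q * (qnum P.q j * csqrt P.q ^ ((P.N : ℤ) - 2 * (j : ℕ)))
    else 0 := by
  change ((P.r / P.rootN * csqrt (qnum P.q 2) * P.q) • (P.Xp * P.qH 1)) i j = _
  rw [Matrix.smul_apply, qH, Matrix.mul_diagonal, Xp, Matrix.of_apply]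
  split_ifs <;> simp

theorem x_two_apply (i j : Fin (P.N + 1)) : P.x 2 i j = if (i : ℕ) = j + 1 then
    -(P.r / P.rootN * csqrt (qnum P.q 2) * P.q⁻¹) *
      (qnum P.q (P.N - j) * csqrt P.q ^ ((P.N : ℤ) - 2 * (j : ℕ)))
    else 0 := by
  change (-(P.r / P.rootN * csqrt (qnum P.q 2) * P.q⁻¹) • (P.Xm * P.qH 1)) i j = _
  rw [Matrix.smul_apply, qH, Matrix.mul_diagonal, Xm, Matrix.of_apply]
  split_ifs <;> simp

/-- Diagonal entries of `X⁺ q^{H/2} X⁻ q^{H/2}`. -/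
def da (k : ℕ) : ℂ := qnum P.q (k + 1) * qnum P.q (P.N - k) * P.q ^ ((P.N : ℤ) - 2 * k - 1)

/-- Diagonal entries of `X⁻ q^{H/2} X⁺ q^{H/2}`. -/
def db (k : ℕ) : ℂ := qnum P.q k * qnum P.q (P.N + 1 - k) * P.q ^ ((P.N : ℤ) - 2 * k + 1)

theorem XpXm : (P.Xp * P.qH 1) * (P.Xm * P.qH 1) =
    Matrix.diagonal fun k : Fin (P.N + 1) => P.da k := by
  ext i j
  rw [Matrix.mul_assoc, Xp_mul_apply]
  simp only [qH_mul_apply]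
  have hi := i.2
  by_cases hij : i = j
  · subst hij
    rw [Matrix.diagonal_apply_eq]
    split_ifs with h
    · rw [da, ← root_zpow]
      have : 2 * ((P.N : ℤ) - 2 * (i : ℕ) - 1)
        = 1 * ((P.N : ℤ) - 2 * ((i + 1 : ℕ) : ℤ)) + 1 * ((P.N : ℤ) - 2 * (i : ℕ)) := by
        push_cast; ring
      rw [this, zpow_add₀ P.root_ne]
      simp [Xm, qH, Matrix.mul_diagonal]; ring
    · have h3 : P.N - i = 0 := by omega
      simp [da, h3, qnum]
  · rw [Matrix.diagonal_apply_ne _ hij]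
    have hij' : (i : ℕ) ≠ j := fun e => hij (Fin.ext e)
    split_ifs with h <;> simp [Xm, qH, Matrix.mul_diagonal, hij']

theorem XmXp : (P.Xm * P.qH 1) * (P.Xp * P.qH 1) =
    Matrix.diagonal fun k : Fin (P.N + 1) => P.db k := by
  ext i j
  rw [Matrix.mul_assoc, Xm_mul_apply]
  simp only [qH_mul_apply]
  have hi := i.2
  by_cases hij : i = j
  · subst hij
    rw [Matrix.diagonal_apply_eq]
    split_ifs with h
    · rw [db, ← root_zpow]
      have : 2 * ((P.N : ℤ) - 2 * (i : ℕ) + 1)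
        = 1 * ((P.N : ℤ) - 2 * ((i - 1 : ℕ) : ℤ)) + 1 * ((P.N : ℤ) - 2 * (i : ℕ)) := by
        push_cast [h]; ring
      have h2 : (i : ℕ) - 1 + 1 = i := by omega
      rw [this, zpow_add₀ P.root_ne]
      simp [Xp, qH, Matrix.mul_diagonal, h2]; ring
    · have h3 : (i : ℕ) = 0 := by omega
      simp [db, h3, qnum]
  · rw [Matrix.diagonal_apply_ne _ hij]
    have hij' : (i : ℕ) ≠ j := fun e => hij (Fin.ext e)
    split_ifs with h
    · have h2 : (i : ℕ) - 1 + 1 ≠ j := by omega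
      simp [Xp, qH, Matrix.mul_diagonal, h2]
    · rfl

theorem rootN_ne : P.rootN ≠ 0 := csqrt_ne (mul_ne_zero
  (P.qnum_ne _ P.one_le (by omega)) (P.qnum_ne _ (by omega) le_rfl))

theorem scal1 (k m : ℕ) (h : k + m = P.N) :
    P.dl k ^ 2 + qnum P.q 2 * (P.q * P.da k + P.q⁻¹ * P.db k) = qnum P.q P.N * qnum P.q (P.N + 2) := by
  have hq := P.q_ne
  have e1 : P.N + 1 - k = m + 1 := by omega
  have e2 : P.N - k = m := by omega
  have e3 : P.q ^ ((P.N : ℤ) - 2 * k - 1) = P.q ^ m * (P.q ^ k)⁻¹ * P.q⁻¹ := by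
    rw [← zpow_natCast, ← zpow_natCast, ← zpow_neg, ← zpow_neg_one, ← zpow_add₀ hq, ← zpow_add₀ hq]
    congr 1; rw [← h]; push_cast; ring
  have e4 : P.q ^ ((P.N : ℤ) - 2 * k + 1) = P.q ^ m * (P.q ^ k)⁻¹ * P.q := by
    rw [← zpow_natCast, ← zpow_natCast, ← zpow_neg, ← zpow_add₀ hq, ← zpow_add_one₀ hq]
    congr 1; rw [← h]; push_cast; ring
  have k1 := qnum_lam hq k
  have m1 := qnum_lam hq m
  have hk : P.q ^ k ≠ 0 := pow_ne_zero _ hq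
  have hm : P.q ^ m ≠ 0 := pow_ne_zero _ hq
  rw [dl, da, db, e1, e2, e3, e4, ← h, qnum_add hq (k + m) 2, qnum_add hq k m, qnum_succ hq k,
    qnum_succ hq m, qnum_two hq, pow_add]
  clear e1 e2 e3 e4 h
  generalize P.q ^ k = u at *
  generalize P.q ^ m = v at *
  generalize qnum P.q k = K at *
  generalize qnum P.q m = M at *
  generalize P.q = q at *
  simp only [mul_inv] at *
  have hqi := mul_inv_cancel₀ hq
  have hui := mul_inv_cancel₀ hk
  have hvi := mul_inv_cancel₀ hm
  clear hq hk hm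
  generalize q⁻¹ = q' at *
  generalize u⁻¹ = u' at *
  generalize v⁻¹ = v' at *
  grind

theorem scal2 (k m : ℕ) (h : k + m = P.N) :
    (P.q - P.q⁻¹) * P.dl k ^ 2 - qnum P.q 2 * (P.da k - P.db k) =
      qnum (P.q ^ (P.N + 1)) 2 * P.dl k := by
  have hq := P.q_ne
  have e1 : P.N + 1 - k = m + 1 := by omega
  have e2 : P.N - k = m := by omega
  have e3 : P.q ^ ((P.N : ℤ) - 2 * k - 1) = P.q ^ m * (P.q ^ k)⁻¹ * P.q⁻¹ := by
    rw [← zpow_natCast, ← zpow_natCast, ← zpow_neg, ← zpow_neg_one, ← zpow_add₀ hq, ← zpow_add₀ hq]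
    congr 1; rw [← h]; push_cast; ring
  have e4 : P.q ^ ((P.N : ℤ) - 2 * k + 1) = P.q ^ m * (P.q ^ k)⁻¹ * P.q := by
    rw [← zpow_natCast, ← zpow_natCast, ← zpow_neg, ← zpow_add₀ hq, ← zpow_add_one₀ hq]
    congr 1; rw [← h]; push_cast; ring
  have k1 := qnum_lam hq k
  have m1 := qnum_lam hq m
  have hk : P.q ^ k ≠ 0 := pow_ne_zero _ hq
  have hm : P.q ^ m ≠ 0 := pow_ne_zero _ hq
  rw [qnum_two (pow_ne_zero _ hq), dl, da, db, e1, e2, e3, e4, ← h, qnum_succ hq k,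
    qnum_succ hq m, qnum_two hq]
  simp only [pow_succ, pow_add]
  clear e1 e2 e3 e4 h
  generalize P.q ^ k = u at *
  generalize P.q ^ m = v at *
  generalize qnum P.q k = K at *
  generalize qnum P.q m = M at *
  generalize P.q = q at *
  simp only [mul_inv] at *
  have hqi := mul_inv_cancel₀ hq
  have hui := mul_inv_cancel₀ hk
  have hvi := mul_inv_cancel₀ hm
  clear hq hk hm
  generalize q⁻¹ = q' at *
  generalize u⁻¹ = u' at *
  generalize v⁻¹ = v' at *
  grind

theorem scal3 (k m : ℕ) (h : k + 1 + m = P.N) :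
    P.q * P.dl (k + 1) - P.q⁻¹ * P.dl k = qnum (P.q ^ (P.N + 1)) 2 := by
  have hq := P.q_ne
  have e1 : P.N + 1 - k = m + 1 + 1 := by omega
  have e2 : P.N - k = m + 1 := by omega
  have e3 : P.N + 1 - (k + 1) = m + 1 := by omega
  have e4 : P.N - (k + 1) = m := by omega
  have k1 := qnum_lam hq k
  have m1 := qnum_lam hq m
  have hk : P.q ^ k ≠ 0 := pow_ne_zero _ hq
  have hm : P.q ^ m ≠ 0 := pow_ne_zero _ hq
  rw [qnum_two (pow_ne_zero _ hq), dl, dl, e1, e2, e3, e4, ← h, qnum_succ hq (k + 1),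
    qnum_succ hq (m + 1), qnum_succ hq k, qnum_succ hq m]
  simp only [pow_succ, pow_add]
  clear e1 e2 e3 e4 h
  generalize P.q ^ k = u at *
  generalize P.q ^ m = v at *
  generalize qnum P.q k = K at *
  generalize qnum P.q m = M at *
  generalize P.q = q at *
  simp only [mul_inv] at *
  have hqi := mul_inv_cancel₀ hq
  have hui := mul_inv_cancel₀ hk
  have hvi := mul_inv_cancel₀ hm
  clear hq hk hm
  generalize q⁻¹ = q' at *
  generalize u⁻¹ = u' at *
  generalize v⁻¹ = v' at *
  grind

theorem eps_simp (q : ℂ) (F : Fin 3 → Fin 3 → P.Fun) (k : Fin 3) :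
    ∑ i, ∑ j, eps q i j k • F i j =
      (![q • F 0 1 - q⁻¹ • F 1 0, F 0 2 + (q - q⁻¹) • F 1 1 - F 2 0,
        q • F 1 2 - q⁻¹ • F 2 1] : Fin 3 → P.Fun) k := by
  fin_cases k <;> simp [eps, Fin.sum_univ_three] <;> module

theorem g_simp (q : ℂ) (F : Fin 3 → Fin 3 → P.Fun) :
    ∑ i, ∑ j, g q i j • F i j = -q • F 0 2 + F 1 1 - q⁻¹ • F 2 0 := by
  simp [g, Fin.sum_univ_three]; module

theorem x_zero : P.x 0 = (P.r / P.rootN * csqrt (qnum P.q 2) * P.q) • (P.Xp * P.qH 1) := rfl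
theorem x_two : P.x 2 = -(P.r / P.rootN * csqrt (qnum P.q 2) * P.q⁻¹) • (P.Xm * P.qH 1) := rfl

/-- `g^{ij} x_i x_j = r²`. -/
theorem x_mul_x : ∑ i, ∑ j, g P.q i j • (P.x i * P.x j) = ((P.r : ℂ) ^ 2) • (1 : P.Fun) := by
  have hq := P.q_ne
  have h2 := csqrt_sq (qnum P.q 2)
  have hr := P.rootN_ne
  have hN : P.rootN ^ 2 = qnum P.q P.N * qnum P.q (P.N + 2) := csqrt_sq _
  rw [g_simp (F := fun i j => P.x i * P.x j)]
  simp only [x_zero, x_one, x_two, smul_mul_smul_comm, XpXm, XmXp, Matrix.diagonal_mul_diagonal,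
    smul_smul]
  ext i j
  by_cases hij : i = j
  · subst hij
    have := P.scal1 i (P.N - i) (by have := i.2; omega)
    simp only [Matrix.add_apply, Matrix.sub_apply, Matrix.smul_apply, Matrix.diagonal_apply_eq,
      Matrix.one_apply_eq, smul_eq_mul]
    have e : (P.r : ℂ) ^ 2 = (P.r / P.rootN) ^ 2 * P.rootN ^ 2 := by field_simp
    rw [e, hN, ← this]
    generalize (P.r / P.rootN : ℂ) = c
    linear_combination (P.q * c ^ 2 * P.da i + P.q⁻¹ * c ^ 2 * P.db i) * (h2 + (csqrt (qnum P.q 2)) ^ 2 * mul_inv_cancel₀ hq)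
  · simp [hij]

/-- `ε_k^{ij} x_i x_j = Λ_N x_k`. -/
theorem eps_x_x (k : Fin 3) : ∑ i, ∑ j, eps P.q i j k • (P.x i * P.x j) = P.Lam • P.x k := by
  have hq := P.q_ne
  have h2 := csqrt_sq (qnum P.q 2)
  have hr := P.rootN_ne
  have hL : P.Lam = (P.r / P.rootN) * qnum (P.q ^ (P.N + 1)) 2 := by rw [Lam]; ring
  rw [eps_simp (F := fun i j => P.x i * P.x j)]
  fin_cases k
  · change P.q • (P.x 0 * P.x 1) - P.q⁻¹ • (P.x 1 * P.x 0) = P.Lam • P.x 0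
    ext i j
    rw [x_one, Matrix.sub_apply, Matrix.smul_apply, Matrix.smul_apply, Matrix.mul_smul,
      Matrix.smul_mul, Matrix.smul_apply, Matrix.smul_apply, Matrix.smul_apply,
      Matrix.mul_diagonal, Matrix.diagonal_mul, x_zero_apply, hL]
    split_ifs with h
    · have := P.scal3 i (P.N - j) (by have := j.2; omega)
      rw [← this, h]
      simp only [smul_eq_mul]; ring
    · simp
  · change P.x 0 * P.x 2 + (P.q - P.q⁻¹) • (P.x 1 * P.x 1) - P.x 2 * P.x 0 = P.Lam • P.x 1
    simp only [x_zero, x_one, x_two, smul_mul_smul_comm, XpXm, XmXp, Matrix.diagonal_mul_diagonal,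
      smul_smul, hL]
    ext i j
    by_cases hij : i = j
    · subst hij
      have := P.scal2 i (P.N - i) (by have := i.2; omega)
      simp only [Matrix.add_apply, Matrix.sub_apply, Matrix.smul_apply, Matrix.diagonal_apply_eq,
        smul_eq_mul]
      generalize (P.r / P.rootN : ℂ) = c
      linear_combination c ^ 2 * this + c ^ 2 * (P.db i - P.da i) *
        (h2 + (csqrt (qnum P.q 2)) ^ 2 * (mul_inv_cancel₀ hq))
    · simp [hij]
  · change P.q • (P.x 1 * P.x 2) - P.q⁻¹ • (P.x 2 * P.x 1) = P.Lam • P.x 2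
    ext i j
    rw [x_one, Matrix.sub_apply, Matrix.smul_apply, Matrix.smul_apply, Matrix.mul_smul,
      Matrix.smul_mul, Matrix.smul_apply, Matrix.smul_apply, Matrix.smul_apply,
      Matrix.mul_diagonal, Matrix.diagonal_mul, x_two_apply, hL]
    split_ifs with h
    · have := P.scal3 j (P.N - i) (by have := i.2; omega)
      rw [← this, h]
      simp only [smul_eq_mul]; ring
    · simp

theorem x_zero_pow_apply (n : ℕ) (i j : Fin (P.N + 1)) :
    ((P.x 0 ^ n) i j ≠ 0) ↔ (i : ℕ) + n = j := by
  induction n generalizing i with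
  | zero => simp [Matrix.one_apply, Fin.ext_iff]
  | succ n ih =>
    rw [pow_succ', Matrix.mul_apply]
    by_cases h : (i : ℕ) + 1 < P.N + 1
    · rw [Finset.sum_eq_single ⟨i + 1, h⟩]
      · rw [mul_ne_zero_iff, ih, x_zero_apply, if_pos rfl]
        have h1 : P.r / P.rootN * csqrt (qnum P.q 2) * P.q * (qnum P.q ((⟨i + 1, h⟩ : Fin (P.N + 1)) : ℕ) *
            csqrt P.q ^ ((P.N : ℤ) - 2 * (((⟨i + 1, h⟩ : Fin (P.N + 1)) : ℕ)))) ≠ 0 := by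
          have := P.q_ne
          have := P.rootN_ne
          have := P.r_ne
          have := csqrt_ne (P.qnum_ne 2 (by omega) (by have := P.one_le; omega))
          have := zpow_ne_zero ((P.N : ℤ) - 2 * ((i + 1 : ℕ))) P.root_ne
          have := P.qnum_ne (i + 1) (by omega) (by omega)
          simp_all
        simp only [h1, ne_eq, not_false_eq_true, true_and]
        constructor <;> intro h <;> omega
      · intro b _ hb
        have : (i : ℕ) + 1 ≠ b := fun e => hb (Fin.ext e.symm)
        rw [x_zero_apply, if_neg this, zero_mul]
      · simp
    · rw [Finset.sum_eq_zero]
      · have := j.2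
        simp; omega
      · intro b _
        have : (i : ℕ) + 1 ≠ b := by have := b.2; omega
        rw [x_zero_apply, if_neg this, zero_mul]

theorem x_two_pow_apply (n : ℕ) (i j : Fin (P.N + 1)) :
    ((P.x 2 ^ n) i j ≠ 0) ↔ (i : ℕ) = j + n := by
  induction n generalizing j with
  | zero => simp [Matrix.one_apply, Fin.ext_iff]
  | succ n ih =>
    rw [pow_succ, Matrix.mul_apply]
    by_cases h : (j : ℕ) + 1 < P.N + 1
    · rw [Finset.sum_eq_single ⟨j + 1, h⟩]
      · rw [mul_ne_zero_iff, ih, x_two_apply, if_pos rfl]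
        have h1 : -(P.r / P.rootN * csqrt (qnum P.q 2) * P.q⁻¹) * (qnum P.q (P.N - j) *
            csqrt P.q ^ ((P.N : ℤ) - 2 * (j : ℕ))) ≠ 0 := by
          have := P.q_ne
          have := P.rootN_ne
          have := P.r_ne
          have := csqrt_ne (P.qnum_ne 2 (by omega) (by have := P.one_le; omega))
          have := zpow_ne_zero ((P.N : ℤ) - 2 * (j : ℕ)) P.root_ne
          have := P.qnum_ne (P.N - j) (by omega) (by omega)
          simp_all
        simp only [h1, ne_eq, not_false_eq_true, and_true]
        constructor <;> intro h <;> omega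
      · intro b _ hb
        have : (b : ℕ) ≠ j + 1 := fun e => hb (Fin.ext e)
        rw [x_two_apply, if_neg this, mul_zero]
      · simp
    · rw [Finset.sum_eq_zero]
      · have := i.2
        simp; omega
      · intro b _
        have : (b : ℕ) ≠ j + 1 := by have := b.2; omega
        rw [x_two_apply, if_neg this, mul_zero]

/-- The coordinate functions generate the whole matrix algebra. -/
theorem adjoin_x : Algebra.adjoin ℂ (Set.range P.x) = ⊤ := by
  rw [eq_top_iff]
  rintro f -
  have hx : ∀ i, P.x i ∈ Algebra.adjoin ℂ (Set.range P.x) :=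
    fun i => Algebra.subset_adjoin ⟨i, rfl⟩
  rw [Matrix.matrix_eq_sum_single f]
  refine sum_mem fun i _ => sum_mem fun j _ => ?_
  obtain ⟨c, hc, h⟩ : ∃ c : ℂ, c ≠ 0 ∧
      P.x 2 ^ (i : ℕ) * P.x 0 ^ P.N * P.x 2 ^ (P.N - j) = Matrix.single i j c := by
    have key : ∀ a b, (P.x 2 ^ (i : ℕ) * P.x 0 ^ P.N * P.x 2 ^ (P.N - j)) a b =
        (P.x 2 ^ (i : ℕ)) a 0 * (P.x 0 ^ P.N) 0 (Fin.last _) * (P.x 2 ^ (P.N - j)) (Fin.last _) b := by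
      intro a b
      rw [Matrix.mul_apply, Finset.sum_eq_single (Fin.last _), Matrix.mul_apply,
        Finset.sum_eq_single 0]
      · intro d _ hd
        by_contra h0
        have := (P.x_zero_pow_apply _ _ _).1 (mul_ne_zero_iff.1 h0).2
        simp at this
        exact hd this
      · simp
      · intro d _ hd
        by_contra h0
        obtain ⟨h1, -⟩ := mul_ne_zero_iff.1 h0
        rw [Matrix.mul_apply] at h1
        obtain ⟨e, -, he⟩ := Finset.exists_ne_zero_of_sum_ne_zero h1
        have := (P.x_zero_pow_apply _ _ _).1 (mul_ne_zero_iff.1 he).2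
        have hd' := d.2
        exact hd (Fin.ext (by simp; omega))
      · simp
    refine ⟨(P.x 2 ^ (i : ℕ) * P.x 0 ^ P.N * P.x 2 ^ (P.N - j)) i j, ?_, ?_⟩
    · rw [key]
      refine mul_ne_zero (mul_ne_zero ?_ ?_) ?_
      · rw [x_two_pow_apply]; simp
      · rw [x_zero_pow_apply]; simp
      · rw [x_two_pow_apply]; simp; omega
    · ext a b
      rw [Matrix.single_apply]
      split_ifs with hab
      · rw [hab.1, hab.2]
      · rw [key]
        by_contra h0
        obtain ⟨h1, h2⟩ := mul_ne_zero_iff.1 h0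
        obtain ⟨h1, -⟩ := mul_ne_zero_iff.1 h1
        rw [x_two_pow_apply] at h1 h2
        simp at h1 h2
        exact hab ⟨Fin.ext (by omega), Fin.ext (by omega)⟩
  have e : Matrix.single i j (f i j) = (f i j / c) • Matrix.single i j c := by
    rw [Matrix.smul_single, smul_eq_mul, div_mul_cancel₀ _ hc]
  rw [e, ← h]
  exact Subalgebra.smul_mem _ (mul_mem (mul_mem (pow_mem (hx 2) _) (pow_mem (hx 0) _))
    (pow_mem (hx 2) _)) _

/-! ### The `L`-operators -/

/-- `q^{-H/2} X⁻` in the spin 1 representation, in which `X⁻ x_1 = √[2] x_0` and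
`X⁻ x_0 = √[2] x_{-1}`. -/
def spinXm : Matrix (Fin 3) (Fin 3) ℂ :=
  Matrix.diagonal (fun i => P.q ^ (-wt i)) * (csqrt (qnum P.q 2) • !![0, 0, 0; 1, 0, 0; 0, 1, 0])

/-- `L⁺^i_j = R₁ π^i_j(R₂)`, where
`R = q^{H ⊗ H / 2} ∑ₙ q^{n(n-1)/2} (q - q⁻¹)ⁿ / [n]! (X⁺ q^{H/2})ⁿ ⊗ (q^{-H/2} X⁻)ⁿ` is the universal
`R`-matrix of `U_q(su(2))`, evaluated on `F_N` in the first factor and in the spin 1 representation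
`π` in the second one (where all terms with `n > 2` vanish). -/
def Lplus (i j : Fin 3) : P.Fun := ∑ n ∈ Finset.range 3,
  (P.q ^ n.choose 2 * (P.q - P.q⁻¹) ^ n / qfact P.q n * (P.spinXm ^ n) i j) •
    (P.qH (2 * wt i) * (P.Xp * P.qH 1) ^ n)

/-- `S(L⁺^i_j) = R₁⁻¹ π^i_j(R₂⁻¹)`, where
`R⁻¹ = (∑ₙ (-1)ⁿ q^{-n(n-1)/2} (q - q⁻¹)ⁿ / [n]! (X⁺ q^{H/2})ⁿ ⊗ (q^{-H/2} X⁻)ⁿ) q^{-H ⊗ H / 2}`. -/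
def SLplus (i j : Fin 3) : P.Fun := ∑ n ∈ Finset.range 3,
  ((-1) ^ n * P.q⁻¹ ^ n.choose 2 * (P.q - P.q⁻¹) ^ n / qfact P.q n * (P.spinXm ^ n) i j) •
    ((P.Xp * P.qH 1) ^ n * P.qH (-2 * wt j))

theorem qH_mul (a b : ℤ) : P.qH a * P.qH b = P.qH (a + b) := by
  simp only [qH, Matrix.diagonal_mul_diagonal]
  congr 1; funext k
  rw [← zpow_add₀ P.root_ne, add_mul]

theorem qH_zero : P.qH 0 = 1 := by simp [qH]

theorem Lplus_mul_SLplus (i j : Fin 3) :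
    ∑ k, P.Lplus i k * P.SLplus k j = if i = j then 1 else 0 := by
  have hq := P.q_ne
  have h2 : qnum P.q 2 ≠ 0 := P.qnum_ne 2 (by omega) (by have := P.one_le; omega)
  have h1 : qnum P.q 1 = 1 := by simp [qnum]
  have h0 : P.q ^ 2 + 1 ≠ 0 := by
    rw [qnum_two hq] at h2; intro h; apply h2; field_simp; simpa using h
  generalize hE : P.Xp * P.qH 1 = E
  fin_cases i <;> fin_cases j <;>
    simp [Lplus, SLplus, hE, Finset.sum_range_succ, Fin.sum_univ_three, spinXm, pow_two,
      Matrix.mul_apply, wt, qfact, h1, qH_mul, qH_zero, Finset.prod_range_succ,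
      Matrix.diagonal_apply, Matrix.one_apply, ← mul_assoc]
  · rw [← add_smul]
    convert zero_smul ℂ _ using 2
    ring
  · rw [smul_smul, ← add_smul, ← add_smul]
    convert zero_smul ℂ _ using 2
    have := csqrt_sq (qnum P.q 2)
    have e := qnum_two hq
    generalize csqrt (qnum P.q 2) = w at *
    rw [e] at this ⊢
    rw [e] at h2
    field_simp
    ring_nf
  · rw [← add_smul]
    convert zero_smul ℂ _ using 2
    ring

/-! ### The differential calculus -/

/-- The defining relations of the algebra of differential forms: the functions form a subalgebra,
`x_i ξ_j = R̂^{kl}_{ij} ξ_k x_l`, and `ξ_i ξ_j = - q² R̂^{kl}_{ij} ξ_k ξ_l`. -/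
inductive FormRel : FreeAlgebra ℂ (P.Fun ⊕ Fin 3) → FreeAlgebra ℂ (P.Fun ⊕ Fin 3) → Prop
  | one : FormRel (FreeAlgebra.ι ℂ (Sum.inl 1)) 1
  | add (f h : P.Fun) : FormRel (FreeAlgebra.ι ℂ (Sum.inl (f + h)))
      (FreeAlgebra.ι ℂ (Sum.inl f) + FreeAlgebra.ι ℂ (Sum.inl h))
  | smul (c : ℂ) (f : P.Fun) : FormRel (FreeAlgebra.ι ℂ (Sum.inl (c • f)))
      (c • FreeAlgebra.ι ℂ (Sum.inl f))
  | mul (f h : P.Fun) : FormRel (FreeAlgebra.ι ℂ (Sum.inl (f * h)))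
      (FreeAlgebra.ι ℂ (Sum.inl f) * FreeAlgebra.ι ℂ (Sum.inl h))
  | braid (i j : Fin 3) : FormRel
      (FreeAlgebra.ι ℂ (Sum.inl (P.x i)) * FreeAlgebra.ι ℂ (Sum.inr j))
      (∑ k, ∑ l, Rhat P.q k l i j •
        (FreeAlgebra.ι ℂ (Sum.inr k) * FreeAlgebra.ι ℂ (Sum.inl (P.x l))))
  | antisymm (i j : Fin 3) : FormRel
      (FreeAlgebra.ι ℂ (Sum.inr i) * FreeAlgebra.ι ℂ (Sum.inr j))
      (-(P.q ^ 2) • ∑ k, ∑ l, Rhat P.q k l i j •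
        (FreeAlgebra.ι ℂ (Sum.inr k) * FreeAlgebra.ι ℂ (Sum.inr l)))

/-- The algebra `Ω*` of differential forms. -/
def Form : Type := RingQuot P.FormRel

instance : Ring P.Form := inferInstanceAs (Ring (RingQuot P.FormRel))

instance : Algebra ℂ P.Form := inferInstanceAs (Algebra ℂ (RingQuot P.FormRel))

/-- The quotient map onto `Ω*`. -/
def toForm : FreeAlgebra ℂ (P.Fun ⊕ Fin 3) →ₐ[ℂ] P.Form := RingQuot.mkAlgHom ℂ P.FormRel

theorem toForm_rel {a b : FreeAlgebra ℂ (P.Fun ⊕ Fin 3)} (h : P.FormRel a b) : P.toForm a = P.toForm b :=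
  RingQuot.mkAlgHom_rel ℂ h

/-- The inclusion of the functions into the differential forms. -/
def fn : P.Fun →ₐ[ℂ] P.Form :=
  AlgHom.ofLinearMap
    { toFun := fun f => P.toForm (FreeAlgebra.ι ℂ (Sum.inl f))
      map_add' := fun f h => by
        rw [P.toForm_rel (FormRel.add f h), map_add]
      map_smul' := fun c f => by
        rw [P.toForm_rel (FormRel.smul c f), map_smul]; rfl }
    (by change P.toForm _ = 1
        rw [P.toForm_rel FormRel.one, map_one])
    (fun f h => by
      change P.toForm _ = P.toForm _ * _
      rw [P.toForm_rel (FormRel.mul f h), map_mul]; rfl)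

/-- The basic one-forms `ξ_1, ξ_0, ξ_{-1}`. -/
def xi (i : Fin 3) : P.Form := P.toForm (FreeAlgebra.ι ℂ (Sum.inr i))

theorem fn_x_mul_xi (i j : Fin 3) :
    P.fn (P.x i) * P.xi j = ∑ k, ∑ l, Rhat P.q k l i j • (P.xi k * P.fn (P.x l)) := by
  have := P.toForm_rel (FormRel.braid (P := P) i j)
  simp only [map_mul, map_sum, map_smul] at this
  exact this

theorem xi_mul_xi (i j : Fin 3) :
    P.xi i * P.xi j = -(P.q ^ 2) • ∑ k, ∑ l, Rhat P.q k l i j • (P.xi k * P.xi l) := by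
  have := P.toForm_rel (FormRel.antisymm (P := P) i j)
  simp only [map_mul, map_sum, map_smul] at this
  exact this

/-- The one-forms: the right module over the functions spanned by the `ξ_i`. -/
def oneForms : Submodule ℂ P.Form :=
  Submodule.span ℂ (Set.range fun p : Fin 3 × P.Fun => P.xi p.1 * P.fn p.2)

theorem xi_fn_mem (i : Fin 3) (f : P.Fun) : P.xi i * P.fn f ∈ P.oneForms :=
  Submodule.subset_span ⟨(i, f), rfl⟩

theorem mem_mul_fn {α : P.Form} (h : α ∈ P.oneForms) (f : P.Fun) : α * P.fn f ∈ P.oneForms := by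
  induction h using Submodule.span_induction with
  | mem a ha =>
    obtain ⟨⟨i, e⟩, rfl⟩ := ha
    rw [mul_assoc, ← map_mul]; exact P.xi_fn_mem i _
  | zero => simp
  | add a b _ _ ha hb => rw [add_mul]; exact add_mem ha hb
  | smul c a _ ha => rw [smul_mul_assoc]; exact Submodule.smul_mem _ _ ha

theorem fn_mul_mem {α : P.Form} (h : α ∈ P.oneForms) (f : P.Fun) : P.fn f * α ∈ P.oneForms := by
  have hf : f ∈ Algebra.adjoin ℂ (Set.range P.x) := by rw [P.adjoin_x]; trivial
  revert α
  induction hf using Algebra.adjoin_induction with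
  | mem f hf =>
    obtain ⟨i, rfl⟩ := hf
    intro α h
    induction h using Submodule.span_induction with
    | mem a ha =>
      obtain ⟨⟨j, e⟩, rfl⟩ := ha
      rw [← mul_assoc, fn_x_mul_xi]
      refine P.mem_mul_fn (Submodule.sum_mem _ fun k _ => Submodule.sum_mem _ fun l _ =>
        Submodule.smul_mem _ _ (P.xi_fn_mem k _)) e
    | zero => simp
    | add a b _ _ ha hb => rw [mul_add]; exact add_mem ha hb
    | smul c a _ ha => rw [mul_smul_comm]; exact Submodule.smul_mem _ _ ha
  | algebraMap c =>
    intro α h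
    rw [AlgHom.commutes, ← Algebra.smul_def]; exact Submodule.smul_mem _ _ h
  | add a b _ _ ha hb => intro α h; rw [map_add, add_mul]; exact add_mem (ha h) (hb h)
  | mul a b _ _ ha hb => intro α h; rw [map_mul, mul_assoc]; exact ha (hb h)

theorem xi_mem (i : Fin 3) : P.xi i ∈ P.oneForms := by
  simpa using P.xi_fn_mem i 1

/-- The image `-(q⁻² Λ_N / [2]_{q²}) ε_i^{jk} ξ_j ξ_k` of `ξ_i` under the Hodge star. -/
def starXi (i : Fin 3) : P.Form :=
  -((P.q ^ 2)⁻¹ * P.Lam / qnum (P.q ^ 2) 2) • ∑ j, ∑ k, eps P.q j k i • (P.xi j * P.xi k)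

end Params

theorem Rhat_eq {q : ℂ} (hq : q ≠ 0) (h3 : qnum q 3 ≠ 0) (h2 : qnum (q ^ 2) 2 ≠ 0) (k l i j : Fin 3) :
    Rhat q k l i j = (if k = i ∧ l = j then q ^ 2 else 0) - ∑ n, eps q k l n * eps q i j n
      + ((q ^ 2)⁻¹ - 1) * (g q k l * g q i j) := by
  have e3 : qnum q 3 = q ^ 2 + 1 + (q ^ 2)⁻¹ := by
    rw [Params.qnum_succ hq, Params.qnum_two hq]; field_simp
  have e2 := Params.qnum_two (pow_ne_zero 2 hq)
  have a3 := mul_inv_cancel₀ h3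
  have a2 := mul_inv_cancel₀ h2
  rw [Rhat, projPlus, projMinus, projZero]
  generalize ∑ n, eps q k l n * eps q i j n = A
  generalize g q k l * g q i j = B
  have a0 := mul_inv_cancel₀ hq
  generalize (qnum q 3)⁻¹ = u at *
  generalize (qnum (q ^ 2) 2)⁻¹ = v at *
  rw [e3] at a3
  rw [e2] at a2
  simp only [← inv_pow] at *
  generalize q⁻¹ = p at *
  split_ifs <;> grind


theorem Rhat_sum {M : Type*} [AddCommGroup M] [Module ℂ M] {q : ℂ} (hq : q ≠ 0)
    (h3 : qnum q 3 ≠ 0) (h2 : qnum (q ^ 2) 2 ≠ 0) (i j : Fin 3) (F : Fin 3 → Fin 3 → M) :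
    ∑ k, ∑ l, Rhat q k l i j • F k l = q ^ 2 • F i j
      - (eps q i j 0 • (q • F 0 1 - q⁻¹ • F 1 0)
        + eps q i j 1 • (F 0 2 + (q - q⁻¹) • F 1 1 - F 2 0)
        + eps q i j 2 • (q • F 1 2 - q⁻¹ • F 2 1))
      + (((q ^ 2)⁻¹ - 1) * g q i j) • (-q • F 0 2 + F 1 1 - q⁻¹ • F 2 0) := by
  have hd : ∑ k, ∑ l, (if k = i ∧ l = j then q ^ 2 else 0) • F k l = q ^ 2 • F i j := by
    simp [ite_and]
  simp only [Rhat_eq hq h3 h2, add_smul, sub_smul, Finset.sum_add_distrib, Finset.sum_sub_distrib,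
    hd]
  congr 1
  · congr 1
    simp [eps, Fin.sum_univ_three]
    module
  · simp [g, Fin.sum_univ_three]
    module

/-- The nine relations that are encoded in `R̂`. -/
theorem Rhat_rel {M : Type*} [AddCommGroup M] [Module ℂ M] {q : ℂ} (hq : q ≠ 0)
    (h3 : qnum q 3 ≠ 0) (h2 : qnum (q ^ 2) 2 ≠ 0) (F : Fin 3 → Fin 3 → M) (i j : Fin 3) :
    ∑ k, ∑ l, Rhat q k l i j • F k l =
      (![![q ^ 2 • F 0 0, F 1 0, q⁻¹ ^ 2 • F 2 0],
        ![F 0 1 + (q ^ 2 - q⁻¹ ^ 2) • F 1 0, F 1 1 + (q - q⁻¹ ^ 3) • F 2 0, F 2 1],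
        ![q⁻¹ ^ 2 • F 0 2 + (q - q⁻¹ ^ 3) • F 1 1 + ((q ^ 2 - q⁻¹ ^ 2) * (1 - q⁻¹ ^ 2)) • F 2 0,
          F 1 2 + (q ^ 2 - q⁻¹ ^ 2) • F 2 1, q ^ 2 • F 2 2]] : Fin 3 → Fin 3 → M) i j := by
  have a0 := mul_inv_cancel₀ hq
  rw [Rhat_sum hq h3 h2, ← inv_pow]
  generalize hp : q⁻¹ = p at *
  fin_cases i <;> fin_cases j <;> simp [eps, g, hp]
  all_goals match_scalars <;> grind

set_option maxHeartbeats 1000000 in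
theorem abs_braid {A : Type*} [Ring A] [Algebra ℂ A] {q p : ℂ} (h : q * p = 1)
    (X0 X1 X2 Y0 Y1 Y2 : A)
    (r00 : X0 * Y0 = q ^ 2 • (Y0 * X0))
    (r01 : X0 * Y1 = Y1 * X0)
    (r02 : X0 * Y2 = p ^ 2 • (Y2 * X0))
    (r10 : X1 * Y0 = Y0 * X1 + (q ^ 2 - p ^ 2) • (Y1 * X0))
    (r11 : X1 * Y1 = Y1 * X1 + (q - p ^ 3) • (Y2 * X0))
    (r12 : X1 * Y2 = Y2 * X1)
    (r20 : X2 * Y0 = p ^ 2 • (Y0 * X2) + (q - p ^ 3) • (Y1 * X1) + ((q ^ 2 - p ^ 2) * (1 - p ^ 2)) • (Y2 * X0))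
    (r21 : X2 * Y1 = Y1 * X2 + (q ^ 2 - p ^ 2) • (Y2 * X1))
    (r22 : X2 * Y2 = q ^ 2 • (Y2 * X2)) (Z0 Z1 Z2 : A)
    (z0 : Z0 = q • (Y0 * Y1) - p • (Y1 * Y0))
    (z1 : Z1 = Y0 * Y2 + (q - p) • (Y1 * Y1) - Y2 * Y0)
    (z2 : Z2 = q • (Y1 * Y2) - p • (Y2 * Y1)) :
    (X0 * Z0 = q ^ 2 • (Z0 * X0)) ∧
    (X0 * Z1 = Z1 * X0) ∧
    (X0 * Z2 = p ^ 2 • (Z2 * X0)) ∧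
    (X1 * Z0 = Z0 * X1 + (q ^ 2 - p ^ 2) • (Z1 * X0)) ∧
    (X1 * Z1 = Z1 * X1 + (q - p ^ 3) • (Z2 * X0)) ∧
    (X1 * Z2 = Z2 * X1) ∧
    (X2 * Z0 = p ^ 2 • (Z0 * X2) + (q - p ^ 3) • (Z1 * X1) + ((q ^ 2 - p ^ 2) * (1 - p ^ 2)) • (Z2 * X0)) ∧
    (X2 * Z1 = Z1 * X2 + (q ^ 2 - p ^ 2) • (Z2 * X1)) ∧
    (X2 * Z2 = q ^ 2 • (Z2 * X2)) := by
  have a00 : ∀ B, X0 * (Y0 * B) = q ^ 2 • (Y0 * (X0 * B)) := fun B => by rw [← mul_assoc, r00]; simp [mul_assoc]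
  have a01 : ∀ B, X0 * (Y1 * B) = (Y1 * (X0 * B)) := fun B => by rw [← mul_assoc, r01]; simp [mul_assoc]
  have a02 : ∀ B, X0 * (Y2 * B) = p ^ 2 • (Y2 * (X0 * B)) := fun B => by rw [← mul_assoc, r02]; simp [mul_assoc]
  have a10 : ∀ B, X1 * (Y0 * B) = Y0 * (X1 * B) + (q ^ 2 - p ^ 2) • (Y1 * (X0 * B)) := fun B => by rw [← mul_assoc, r10]; simp only [add_mul, smul_mul_assoc, mul_assoc]
  have a11 : ∀ B, X1 * (Y1 * B) = Y1 * (X1 * B) + (q - p ^ 3) • (Y2 * (X0 * B)) := fun B => by rw [← mul_assoc, r11]; simp only [add_mul, smul_mul_assoc, mul_assoc]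
  have a12 : ∀ B, X1 * (Y2 * B) = Y2 * (X1 * B) := fun B => by rw [← mul_assoc, r12]; simp only [add_mul, smul_mul_assoc, mul_assoc]
  have a20 : ∀ B, X2 * (Y0 * B) = p ^ 2 • (Y0 * (X2 * B)) + (q - p ^ 3) • (Y1 * (X1 * B)) + ((q ^ 2 - p ^ 2) * (1 - p ^ 2)) • (Y2 * (X0 * B)) := fun B => by rw [← mul_assoc, r20]; simp only [add_mul, smul_mul_assoc, mul_assoc]
  have a21 : ∀ B, X2 * (Y1 * B) = Y1 * (X2 * B) + (q ^ 2 - p ^ 2) • (Y2 * (X1 * B)) := fun B => by rw [← mul_assoc, r21]; simp only [add_mul, smul_mul_assoc, mul_assoc]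
  have a22 : ∀ B, X2 * (Y2 * B) = q ^ 2 • (Y2 * (X2 * B)) := fun B => by rw [← mul_assoc, r22]; simp only [smul_mul_assoc, mul_assoc]
  subst z0 z1 z2
  refine ⟨?_, ?_, ?_, ?_, ?_, ?_, ?_, ?_, ?_⟩ <;>
    simp only [mul_add, mul_sub, add_mul, sub_mul, mul_smul_comm, smul_mul_assoc, mul_assoc, a00, a01, a02,
      a10, a11, a12, a20, a21, a22, r00, r01, r02, r10, r11, r12, r20, r21, r22] <;>
    match_scalars <;> grind

theorem abs_star {A : Type*} [Ring A] [Algebra ℂ A] {q p : ℂ} (h : q * p = 1) (hs : q ^ 4 + 1 ≠ 0)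
    (h2 : q ^ 2 + 1 ≠ 0) (Y0 Y1 Y2 : A)
    (r00 : Y0 * Y0 = -q ^ 2 • q ^ 2 • (Y0 * Y0))
    (r10 : Y0 * Y1 = -q ^ 2 • (Y1 * Y0))
    (r20 : Y0 * Y2 = -q ^ 2 • p ^ 2 • (Y2 * Y0))
    (r11 : Y1 * Y1 = -q ^ 2 • (Y1 * Y1 + (q - p ^ 3) • (Y2 * Y0)))
    (r21 : Y1 * Y2 = -q ^ 2 • (Y2 * Y1))
    (r22 : Y2 * Y2 = -q ^ 2 • q ^ 2 • (Y2 * Y2)) (Z0 Z1 Z2 : A)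
    (z0 : Z0 = q • (Y0 * Y1) - p • (Y1 * Y0))
    (z1 : Z1 = Y0 * Y2 + (q - p) • (Y1 * Y1) - Y2 * Y0)
    (z2 : Z2 = q • (Y1 * Y2) - p • (Y2 * Y1)) :
    (Z0 * Y0 = Y0 * Z0) ∧ (Z0 * Y1 = Y0 * Z1) ∧ (Z0 * Y2 = Y0 * Z2) ∧
    (Z1 * Y0 = Y1 * Z0) ∧ (Z1 * Y1 = Y1 * Z1) ∧ (Z1 * Y2 = Y1 * Z2) ∧
    (Z2 * Y0 = Y2 * Z0) ∧ (Z2 * Y1 = Y2 * Z1) ∧ (Z2 * Y2 = Y2 * Z2) := by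
  have s00 : Y0 * Y0 = 0 := by
    have : (q ^ 4 + 1) • (Y0 * Y0) = 0 := by
      have e : (q ^ 4 + 1) • (Y0 * Y0) = Y0 * Y0 - (-q ^ 2 • q ^ 2 • (Y0 * Y0)) := by
        match_scalars; ring
      rw [e, ← r00, sub_self]
    exact (smul_eq_zero.1 this).resolve_left hs
  have s22 : Y2 * Y2 = 0 := by
    have : (q ^ 4 + 1) • (Y2 * Y2) = 0 := by
      have e : (q ^ 4 + 1) • (Y2 * Y2) = Y2 * Y2 - (-q ^ 2 • q ^ 2 • (Y2 * Y2)) := by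
        match_scalars; ring
      rw [e, ← r22, sub_self]
    exact (smul_eq_zero.1 this).resolve_left hs
  have s10 : Y1 * Y0 = -p ^ 2 • (Y0 * Y1) := by
    rw [r10]; match_scalars; grind
  have s20 : Y2 * Y0 = (-1 : ℂ) • (Y0 * Y2) := by
    rw [r20]; match_scalars; grind
  have s21 : Y2 * Y1 = -p ^ 2 • (Y1 * Y2) := by
    rw [r21]; match_scalars; grind
  have s11 : Y1 * Y1 = (q - p) • (Y0 * Y2) := by
    have : (q ^ 2 + 1) • (Y1 * Y1 - (q - p) • (Y0 * Y2)) = 0 := by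
      have e : (q ^ 2 + 1) • (Y1 * Y1 - (q - p) • (Y0 * Y2)) =
        (Y1 * Y1 - (-q ^ 2 • (Y1 * Y1 + (q - p ^ 3) • (Y2 * Y0)))) := by
        rw [s20]; match_scalars <;> grind
      rw [e, ← r11, sub_self]
    exact sub_eq_zero.1 ((smul_eq_zero.1 this).resolve_left h2)
  clear r00 r10 r20 r11 r21 r22
  have a00 : ∀ B, Y0 * (Y0 * B) = 0 := fun B => by rw [← mul_assoc, s00, zero_mul]
  have a22 : ∀ B, Y2 * (Y2 * B) = 0 := fun B => by rw [← mul_assoc, s22, zero_mul]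
  have a10 : ∀ B, Y1 * (Y0 * B) = -p ^ 2 • (Y0 * (Y1 * B)) := fun B => by
    rw [← mul_assoc, s10]; simp only [smul_mul_assoc, mul_assoc]
  have a20 : ∀ B, Y2 * (Y0 * B) = (-1 : ℂ) • (Y0 * (Y2 * B)) := fun B => by
    rw [← mul_assoc, s20]; simp only [smul_mul_assoc, mul_assoc]
  have a21 : ∀ B, Y2 * (Y1 * B) = -p ^ 2 • (Y1 * (Y2 * B)) := fun B => by
    rw [← mul_assoc, s21]; simp only [smul_mul_assoc, mul_assoc]
  have a11 : ∀ B, Y1 * (Y1 * B) = (q - p) • (Y0 * (Y2 * B)) := fun B => by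
    rw [← mul_assoc, s11]; simp only [smul_mul_assoc, mul_assoc]
  subst z0 z1 z2
  refine ⟨?_, ?_, ?_, ?_, ?_, ?_, ?_, ?_, ?_⟩ <;>
    simp only [mul_add, mul_sub, add_mul, sub_mul, mul_smul_comm, smul_mul_assoc, mul_assoc,
      a00, a10, a20, a11, a21, a22, s00, s10, s20, s11, s21, s22, mul_zero, smul_zero, add_zero,
      sub_zero, zero_add, sub_self]

namespace Params
variable (P : Params)

theorem qnum_three_ne : qnum P.q 3 ≠ 0 := P.qnum_ne 3 (by omega) (by have := P.one_le; omega)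

/-- `ε_n^{ij} ξ_i ξ_j`. -/
def epsXi (n : Fin 3) : P.Form := ∑ j, ∑ k, eps P.q j k n • (P.xi j * P.xi k)

theorem starXi_eq (n : Fin 3) :
    P.starXi n = -((P.q ^ 2)⁻¹ * P.Lam / qnum (P.q ^ 2) 2) • P.epsXi n := rfl

theorem epsXi_eq (n : Fin 3) : P.epsXi n =
    (![P.q • (P.xi 0 * P.xi 1) - P.q⁻¹ • (P.xi 1 * P.xi 0),
      P.xi 0 * P.xi 2 + (P.q - P.q⁻¹) • (P.xi 1 * P.xi 1) - P.xi 2 * P.xi 0,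
      P.q • (P.xi 1 * P.xi 2) - P.q⁻¹ • (P.xi 2 * P.xi 1)] : Fin 3 → P.Form) n := by
  fin_cases n <;> simp [epsXi, eps, Fin.sum_univ_three] <;> module

theorem fn_x_mul_starXi (i j : Fin 3) :
    P.fn (P.x i) * P.starXi j = ∑ k, ∑ l, Rhat P.q k l i j • (P.starXi k * P.fn (P.x l)) := by
  have key : P.fn (P.x i) * P.epsXi j =
      ∑ k, ∑ l, Rhat P.q k l i j • (P.epsXi k * P.fn (P.x l)) := by
    have R := fun i j => (P.fn_x_mul_xi i j).trans
      (Rhat_rel P.q_ne P.qnum_three_ne P.two_sq_ne (fun k l => P.xi k * P.fn (P.x l)) i j)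
    have H := abs_braid (mul_inv_cancel₀ P.q_ne) _ _ _ _ _ _ (R 0 0) (R 0 1) (R 0 2) (R 1 0)
      (R 1 1) (R 1 2) (R 2 0) (R 2 1) (R 2 2) _ _ _ (P.epsXi_eq 0) (P.epsXi_eq 1) (P.epsXi_eq 2)
    rw [Rhat_rel P.q_ne P.qnum_three_ne P.two_sq_ne (fun k l => P.epsXi k * P.fn (P.x l)) i j]
    obtain ⟨h1, h2, h3, h4, h5, h6, h7, h8, h9⟩ := H
    fin_cases i <;> fin_cases j
    exacts [h1, h2, h3, h4, h5, h6, h7, h8, h9]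
  simp only [starXi_eq, mul_smul_comm, key, Finset.smul_sum, smul_mul_assoc]
  simp only [smul_comm (Rhat _ _ _ _ _)]

theorem starXi_mul_xi (i j : Fin 3) : P.starXi i * P.xi j = P.xi i * P.starXi j := by
  have key : P.epsXi i * P.xi j = P.xi i * P.epsXi j := by
    have R : ∀ i j, P.xi i * P.xi j = _ := fun i j => (P.xi_mul_xi i j).trans
      (congrArg _ (Rhat_rel P.q_ne P.qnum_three_ne P.two_sq_ne (fun k l => P.xi k * P.xi l) i j))
    have r00 : P.xi 0 * P.xi 0 = -P.q ^ 2 • P.q ^ 2 • (P.xi 0 * P.xi 0) := R 0 0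
    have r10 : P.xi 0 * P.xi 1 = -P.q ^ 2 • (P.xi 1 * P.xi 0) := R 0 1
    have r20 : P.xi 0 * P.xi 2 = -P.q ^ 2 • P.q⁻¹ ^ 2 • (P.xi 2 * P.xi 0) := R 0 2
    have r11 : P.xi 1 * P.xi 1 = -P.q ^ 2 • (P.xi 1 * P.xi 1 +
      (P.q - P.q⁻¹ ^ 3) • (P.xi 2 * P.xi 0)) := R 1 1
    have r21 : P.xi 1 * P.xi 2 = -P.q ^ 2 • (P.xi 2 * P.xi 1) := R 1 2
    have r22 : P.xi 2 * P.xi 2 = -P.q ^ 2 • P.q ^ 2 • (P.xi 2 * P.xi 2) := R 2 2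
    have h2 : P.q ^ 2 + 1 ≠ 0 := by
      have := P.qnum_ne 2 (by omega) (by omega)
      rw [qnum_two P.q_ne] at this
      intro h; apply this; have := P.q_ne; field_simp; simpa using h
    have h4 : P.q ^ 4 + 1 ≠ 0 := by
      have := P.two_sq_ne
      rw [qnum_two (pow_ne_zero 2 P.q_ne)] at this
      intro h; apply this; have := P.q_ne; field_simp; linear_combination h
    have H := abs_star (mul_inv_cancel₀ P.q_ne) h4 h2 _ _ _ r00 r10 r20 r11 r21 r22 _ _ _
      (P.epsXi_eq 0) (P.epsXi_eq 1) (P.epsXi_eq 2)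
    obtain ⟨h1, h2, h3, h4, h5, h6, h7, h8, h9⟩ := H
    fin_cases i <;> fin_cases j
    exacts [h1, h2, h3, h4, h5, h6, h7, h8, h9]
  rw [starXi_eq, starXi_eq, smul_mul_assoc, key, mul_smul_comm]

/-- The algebra map `f ↦ diag (f, f)`, `ξ_i ↦ [[-ξ_i, *_H ξ_i], [0, ξ_i]]` on the free algebra. -/
def starAux₀ : FreeAlgebra ℂ (P.Fun ⊕ Fin 3) →ₐ[ℂ] Matrix (Fin 2) (Fin 2) P.Form :=
  FreeAlgebra.lift ℂ (Sum.elim (fun f => !![P.fn f, 0; 0, P.fn f])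
    fun i => !![-P.xi i, P.starXi i; 0, P.xi i])

theorem starAux₀_inl (f : P.Fun) :
    P.starAux₀ (FreeAlgebra.ι ℂ (Sum.inl f)) = !![P.fn f, 0; 0, P.fn f] := by
  rw [starAux₀, FreeAlgebra.lift_ι_apply]; rfl

theorem starAux₀_inr (i : Fin 3) :
    P.starAux₀ (FreeAlgebra.ι ℂ (Sum.inr i)) = !![-P.xi i, P.starXi i; 0, P.xi i] := by
  rw [starAux₀, FreeAlgebra.lift_ι_apply]; rfl

/-- The induced algebra map on differential forms. -/
def starAux : P.Form →ₐ[ℂ] Matrix (Fin 2) (Fin 2) P.Form :=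
  RingQuot.liftAlgHom ℂ ⟨P.starAux₀, fun a b h => by
    cases h with
    | one => rw [starAux₀_inl, map_one, map_one]; exact Matrix.one_fin_two.symm
    | add f h => simp [starAux₀_inl]
    | smul c f => simp [starAux₀_inl]
    | mul f h => simp [starAux₀_inl]
    | braid i j =>
      simp only [map_mul, map_sum, map_smul, starAux₀_inl, starAux₀_inr]
      ext a b
      have h1 := P.fn_x_mul_xi i j
      have h2 := P.fn_x_mul_starXi i j
      fin_cases a <;> fin_cases b <;> simp [Matrix.sum_apply, h1, h2]
    | antisymm i j =>
      simp only [map_mul, map_sum, map_smul, starAux₀_inr]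
      ext a b
      have h1 := P.xi_mul_xi i j
      fin_cases a <;> fin_cases b <;>
        simp [Matrix.sum_apply, starXi_mul_xi, ← h1]⟩

theorem starAux_toForm (a : FreeAlgebra ℂ (P.Fun ⊕ Fin 3)) :
    P.starAux (P.toForm a) = P.starAux₀ a :=
  RingQuot.liftAlgHom_mkAlgHom_apply ..

theorem existsUnique_star : ∃! S : P.oneForms →ₗ[ℂ] P.Form,
    ∀ i f, S ⟨P.xi i * P.fn f, P.xi_fn_mem i f⟩ = P.starXi i * P.fn f := by
  have ext : ∀ S T : P.oneForms →ₗ[ℂ] P.Form,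
      (∀ i f, S ⟨P.xi i * P.fn f, P.xi_fn_mem i f⟩ = T ⟨P.xi i * P.fn f, P.xi_fn_mem i f⟩) →
      S = T := by
    intro S T h
    have htop : Submodule.span ℂ (Set.range fun p : Fin 3 × P.Fun =>
        (⟨P.xi p.1 * P.fn p.2, P.xi_fn_mem p.1 p.2⟩ : P.oneForms)) = ⊤ := by
      rw [← (Submodule.map_injective_of_injective P.oneForms.injective_subtype).eq_iff,
        Submodule.map_span, ← Set.range_comp, Submodule.map_subtype_top]
      rfl
    refine LinearMap.ext_on htop ?_
    rintro _ ⟨⟨i, f⟩, rfl⟩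
    exact h i f
  have val : ∀ i f, P.starAux (P.xi i * P.fn f) 0 1 = P.starXi i * P.fn f := by
    intro i f
    have h1 : P.starAux (P.xi i) = !![-P.xi i, P.starXi i; 0, P.xi i] := by
      exact (P.starAux_toForm _).trans (P.starAux₀_inr i)
    have h2 : P.starAux (P.fn f) = !![P.fn f, 0; 0, P.fn f] :=
      (P.starAux_toForm _).trans (P.starAux₀_inl f)
    rw [map_mul, h1, h2]; simp
  refine ⟨⟨⟨fun α => P.starAux α 0 1, fun α β => by simp⟩, fun c α => by simp⟩, fun i f => ?_,
    fun S hS => ext _ _ fun i f => ?_⟩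
  · exact val i f
  · rw [hS]; exact (val i f).symm

/-- The Hodge star on one-forms: the unique map of right modules over the functions with
`ξ_i ↦ -(q⁻² Λ_N / [2]_{q²}) ε_i^{jk} ξ_j ξ_k`. -/
def hodgeStar : P.oneForms →ₗ[ℂ] P.Form := P.existsUnique_star.choose

theorem hodgeStar_xi_fn (i : Fin 3) (f : P.Fun) :
    P.hodgeStar ⟨P.xi i * P.fn f, P.xi_fn_mem i f⟩ = P.starXi i * P.fn f :=
  P.existsUnique_star.choose_spec.1 i f

/-- The invariant one-form `Θ = g^{ij} x_i ξ_j`. -/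
def Theta : P.Form := ∑ i, ∑ j, g P.q i j • (P.fn (P.x i) * P.xi j)

/-- The exterior derivative of a function, `d f = [Θ, f]`. -/
def dFun (f : P.Fun) : P.Form := P.Theta * P.fn f - P.fn f * P.Theta

/-- The exterior derivative of a one-form, `d α = Θ α + α Θ - *_H α`. -/
def dOne (α : P.oneForms) : P.Form := P.Theta * α + α * P.Theta - P.hodgeStar α

/-! ### The frame -/

/-- `λ_a = Λ_N⁻¹ x_i L⁺^i_a`. -/
def lam (a : Fin 3) : P.Fun := P.Lam⁻¹ • ∑ i, P.x i * P.Lplus i a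

/-- `θ^a = Λ_N S(L⁺^a_j) g^{jk} ξ_k`. -/
def theta (a : Fin 3) : P.oneForms :=
  ⟨P.Lam • ∑ j, ∑ k, g P.q j k • (P.fn (P.SLplus a j) * P.xi k),
    Submodule.smul_mem _ _ (Submodule.sum_mem _ fun j _ => Submodule.sum_mem _ fun k _ =>
      Submodule.smul_mem _ _ (P.fn_mul_mem (P.xi_mem k) (P.SLplus a j)))⟩

end Params
end QFuzzySphere
end

noncomputable section

namespace QFuzzySphere

/-! Everything rests on one exchange relation, `x_mul_Llow`: the operators g_{im} L⁺^m_a pass the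
coordinates by R̂ in exactly the way the ξ_i do. It is verified in normal form: `Lplus_eq` expresses
L⁺ through x_1 and q^{±H} alone, and (q - q⁻¹) x_0 = Λ_N - ρ [2] q^H (`sub_smul_x_one`) turns the
ε-relations of the sphere into rules for reordering words.

Since ξ_i = Λ_N⁻¹ g_{im} L⁺^m_a θ^a, comparing the two exchange relations shows that R̂, applied to
L-combinations of the commutators [θ^a, x_l], gives zero. Both R̂ and L⁺ are invertible and the x_l
generate all functions, so the frame commutes with every function (`theta_mul_fn`). The same
relation makes ξ_i ↦ Λ_N⁻¹ g_{im} L⁺^m_a extend to Ω* (`frameCoord`); on the frame this takes the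
values δ, whence independence.

For the λ_a, moving L⁺ past a coordinate gives Λ_N² λ_a λ_b as R̂ applied to x x, times L⁺ L⁺
(`lam_mul_lam`). The L-operators intertwine g and ε, which are eigenvectors of R̂ for q⁻⁴ and -q⁻²,
so the relations of the λ_a reduce to those of the x_i.

For the θ^a, the relations of the ξ_i leave only the P⁻ part of ξ_i ξ_j, and S(L⁺) intertwines ε as
well; hence θ^a θ^b is ε^{ba}_c times a two-form `dualFrame c` (`theta_mul_theta`). The braiding,
the Hodge star and dθ^a follow from the eigenvalue and the normalization of ε. Associativity alone
makes all cubic products multiples of one three-form (`cubic_of_eps`), and contracting with three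
λ's compares it with Θ³. -/

theorem mul_mul_of_mul_eq {A : Type*} [Semigroup A] {x y z : A} (h : x * y = z) (w : A) :
    x * (y * w) = z * w := by
  rw [← mul_assoc, h]

/-! ### The exchange relation of coordinates and `L`-operators -/

/-- The commutation relations of the coordinates `a = x_1`, `b = x_0`, `c = x_{-1}` of the sphere
with each other and with `K = q^H` imply that the `L`-operators, the entries of `Y` up to a metric,
are exchanged with the coordinates by `R̂`. -/
theorem exchange_of_relations {A : Type*} [Ring A] [Algebra ℂ A] {q p s s' t t' : ℂ}
    (hq : q * p = 1) (hs : s * s' = 1) (ht : t * t' = 1) (htq : t = q + p) (a b c K K' : A)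
    (hK : K' * K = 1) (hKa : a * K = p ^ 2 • (K * a))
    (hKb : b * K = K * b) (hKc : c * K = q ^ 2 • (K * c)) (hKa' : a * K' = q ^ 2 • (K' * a))
    (hKb' : b * K' = K' * b) (hKc' : c * K' = p ^ 2 • (K' * c))
    (hba : b * a = a * b - (p * s * t) • (K * a))
    (hca : c * a = a * c - (s * t) • (K * b))
    (X : Fin 3 → A) (Y : Fin 3 → Fin 3 → A) (hX : X = ![a, b, c])
    (hY : Y = ![![-(q * (q - p) ^ 2 * s' ^ 2 * t') • (K' * (a * a)),
        -(q * (q - p) * s') • (K' * a), -q • K'],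
      ![((q - p) * s' * p) • a, 1, 0], ![-p • K, 0, 0]]) (i j n : Fin 3) :
    X i * Y j n = (![![q ^ 2 • (Y 0 n * X 0), Y 1 n * X 0, p ^ 2 • (Y 2 n * X 0)],
        ![Y 0 n * X 1 + (q ^ 2 - p ^ 2) • (Y 1 n * X 0), Y 1 n * X 1 + (q - p ^ 3) • (Y 2 n * X 0), Y 2 n * X 1],
        ![p ^ 2 • (Y 0 n * X 2) + (q - p ^ 3) • (Y 1 n * X 1) +
            ((q ^ 2 - p ^ 2) * (1 - p ^ 2)) • (Y 2 n * X 0),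
          Y 1 n * X 2 + (q ^ 2 - p ^ 2) • (Y 2 n * X 1), q ^ 2 • (Y 2 n * X 2)]] :
            Fin 3 → Fin 3 → A) i j := by
  -- The reassociated rules act inside right-nested words. The normal form has K and K' on the left,
  -- then a, then b and c; no rule for b against c is needed because Y only involves a, K and K'.
  have hK2 := mul_mul_of_mul_eq hK
  have hKa2 := mul_mul_of_mul_eq hKa
  have hKa2' := mul_mul_of_mul_eq hKa'
  have hKb2' := mul_mul_of_mul_eq hKb'
  have hKc2' := mul_mul_of_mul_eq hKc'
  have hba2 := mul_mul_of_mul_eq hba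
  have hca2 := mul_mul_of_mul_eq hca
  fin_cases i <;> fin_cases j <;> fin_cases n <;>
    simp [hX, hY, -neg_smul, -neg_mul] <;>
    simp only [mul_sub, sub_mul, mul_assoc, mul_smul_comm, smul_mul_assoc, hKa, hKb, hKc, hKa',
      hKb', hKc', hba, hca, hK2, hKa2, hKa2', hKb2', hKc2', hba2, hca2, one_mul, mul_one] <;>
    match_scalars <;> grind

theorem g_mul_g {q : ℂ} (hq : q ≠ 0) (i j : Fin 3) :
    ∑ k, g q i k * g q k j = if i = j then 1 else 0 := by
  fin_cases i <;> fin_cases j <;> simp [g, Fin.sum_univ_three, hq]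

namespace Params
variable (P : Params)

theorem qnum_two_ne : qnum P.q 2 ≠ 0 := P.qnum_ne 2 (by omega) (by have := P.one_le; omega)

/-- The normalization `ρ = r / √([N] [N + 2])` of the coordinates. -/
def rho : ℂ := P.r / P.rootN

theorem rho_ne : P.rho ≠ 0 := div_ne_zero (by exact_mod_cast P.r_ne) P.rootN_ne

theorem Lam_eq : P.Lam = P.rho * qnum (P.q ^ (P.N + 1)) 2 := by rw [Lam, rho]; ring

theorem Lam_ne : P.Lam ≠ 0 := by
  rw [Lam_eq]; exact mul_ne_zero P.rho_ne P.two_pow_ne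

theorem qH_two_mul_qH_neg_two : P.qH 2 * P.qH (-2) = 1 := by
  rw [qH_mul, add_neg_cancel, qH_zero]

theorem qH_neg_two_mul_qH_two : P.qH (-2) * P.qH 2 = 1 := by
  rw [qH_mul, neg_add_cancel, qH_zero]

theorem qH_two_apply (m : ℤ) :
    P.qH (2 * m) = Matrix.diagonal fun k : Fin (P.N + 1) => P.q ^ (m * ((P.N : ℤ) - 2 * (k : ℕ))) := by
  rw [qH]; congr 1; funext k; rw [← root_zpow, mul_assoc]

theorem x_zero_mul_qH (m : ℤ) : P.x 0 * P.qH (2 * m) = P.q ^ (-2 * m) • (P.qH (2 * m) * P.x 0) := by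
  ext i j
  rw [qH_two_apply, Matrix.mul_diagonal, Matrix.smul_apply, Matrix.diagonal_mul, x_zero_apply]
  split_ifs with h
  · rw [mul_comm, smul_eq_mul, ← mul_assoc (P.q ^ (-2 * m)), ← zpow_add₀ P.q_ne]
    congr 2; rw [← h]; push_cast; ring
  · simp

theorem x_one_mul_qH (m : ℤ) : P.x 1 * P.qH m = P.qH m * P.x 1 := by
  rw [x_one, qH, Matrix.smul_mul, Matrix.mul_smul, Matrix.diagonal_mul_diagonal,
    Matrix.diagonal_mul_diagonal]
  simp only [mul_comm]

theorem x_two_mul_qH (m : ℤ) : P.x 2 * P.qH (2 * m) = P.q ^ (2 * m) • (P.qH (2 * m) * P.x 2) := by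
  ext i j
  rw [qH_two_apply, Matrix.mul_diagonal, Matrix.smul_apply, Matrix.diagonal_mul, x_two_apply]
  split_ifs with h
  · rw [mul_comm, smul_eq_mul, ← mul_assoc (P.q ^ (2 * m)), ← zpow_add₀ P.q_ne]
    congr 2; rw [h]; push_cast; ring
  · simp

theorem x_zero_mul_qH_two : P.x 0 * P.qH 2 = P.q⁻¹ ^ 2 • (P.qH 2 * P.x 0) := by
  have h := P.x_zero_mul_qH 1
  rw [mul_one, mul_one, zpow_neg] at h
  rw [h, inv_pow, ← zpow_natCast]; rfl

theorem x_zero_mul_qH_neg_two : P.x 0 * P.qH (-2) = P.q ^ 2 • (P.qH (-2) * P.x 0) := by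
  have h := P.x_zero_mul_qH (-1)
  rw [mul_neg_one, mul_neg_one, neg_neg] at h
  rw [h, ← zpow_natCast]; rfl

theorem x_two_mul_qH_two : P.x 2 * P.qH 2 = P.q ^ 2 • (P.qH 2 * P.x 2) := by
  have h := P.x_two_mul_qH 1
  rw [mul_one] at h
  rw [h, ← zpow_natCast]; rfl

theorem x_two_mul_qH_neg_two : P.x 2 * P.qH (-2) = P.q⁻¹ ^ 2 • (P.qH (-2) * P.x 2) := by
  have h := P.x_two_mul_qH (-1)
  rw [mul_neg_one, zpow_neg] at h
  rw [h, inv_pow, ← zpow_natCast]; rfl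

theorem sub_mul_dl (k m : ℕ) (h : k + m = P.N) : (P.q - P.q⁻¹) * P.dl k =
    qnum (P.q ^ (P.N + 1)) 2 - qnum P.q 2 * P.q ^ ((P.N : ℤ) - 2 * k) := by
  have hq := P.q_ne
  have e1 : P.N + 1 - k = m + 1 := by omega
  have e2 : P.N - k = m := by omega
  have e3 : P.q ^ ((P.N : ℤ) - 2 * k) = P.q ^ m * (P.q ^ k)⁻¹ := by
    rw [← zpow_natCast, ← zpow_natCast, ← zpow_neg, ← zpow_add₀ hq]
    congr 1; rw [← h]; push_cast; ring
  have k1 := qnum_lam hq k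
  have m1 := qnum_lam hq m
  have hk : P.q ^ k ≠ 0 := pow_ne_zero _ hq
  have hm : P.q ^ m ≠ 0 := pow_ne_zero _ hq
  rw [qnum_two (pow_ne_zero _ hq), dl, e1, e2, e3, ← h, qnum_succ hq k,
    qnum_succ hq m, qnum_two hq]
  simp only [pow_succ, pow_add]
  -- With q^k, q^m, [k], [m] and the inverses as independent variables, the claim is a polynomial
  -- consequence of (q - q⁻¹)[n] = q^n - q⁻ⁿ and of the inverse relations.
  clear e1 e2 e3 h
  generalize P.q ^ k = u at *
  generalize P.q ^ m = v at *
  generalize qnum P.q k = K at *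
  generalize qnum P.q m = M at *
  generalize P.q = q at *
  simp only [mul_inv] at *
  have hqi := mul_inv_cancel₀ hq
  have hui := mul_inv_cancel₀ hk
  have hvi := mul_inv_cancel₀ hm
  clear hq hk hm
  generalize q⁻¹ = q' at *
  generalize u⁻¹ = u' at *
  generalize v⁻¹ = v' at *
  grind

/-- `(q - q⁻¹) x_0 = Λ_N - ρ [2] q^H`. -/
theorem sub_smul_x_one :
    (P.q - P.q⁻¹) • P.x 1 = P.Lam • (1 : P.Fun) - (P.rho * qnum P.q 2) • P.qH 2 := by
  have h2 := P.qH_two_apply 1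
  rw [mul_one] at h2
  rw [x_one, h2, Lam_eq, ← rho]
  ext i j
  by_cases hij : i = j
  · subst hij
    have := P.sub_mul_dl i (P.N - i) (by have := i.2; omega)
    simp only [Matrix.sub_apply, Matrix.smul_apply, Matrix.diagonal_apply_eq, Matrix.one_apply_eq,
      smul_eq_mul, one_mul]
    linear_combination P.rho * this
  · simp [hij]

/-- Equating the two expressions for Λ_N x_1, from the ε-relation and from `sub_smul_x_one`,
eliminates Λ_N; what remains reorders x_0 x_1 at the price of one term with q^H. -/
theorem x_one_mul_x_zero :
    P.x 1 * P.x 0 = P.x 0 * P.x 1 - (P.q⁻¹ * P.rho * qnum P.q 2) • (P.qH 2 * P.x 0) := by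
  have h1 := P.eps_x_x 0
  rw [eps_simp (F := fun i j => P.x i * P.x j)] at h1
  have h2 := congrArg (· * P.x 0) P.sub_smul_x_one
  simp only [sub_mul, smul_mul_assoc, one_mul] at h2
  have h3 : P.q • (P.x 0 * P.x 1) - P.q⁻¹ • (P.x 1 * P.x 0) = P.Lam • P.x 0 := h1
  rw [← h3] at h2
  have h4 : P.q • (P.x 1 * P.x 0) =
      P.q • (P.x 0 * P.x 1) - (P.rho * qnum P.q 2) • (P.qH 2 * P.x 0) := by
    rw [sub_smul] at h2
    linear_combination (norm := module) h2
  have h5 := congrArg (P.q⁻¹ • ·) h4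
  simp only [smul_sub, smul_smul, inv_mul_cancel₀ P.q_ne, one_smul] at h5
  rw [h5, mul_assoc]

/-- The same elimination in weight 0, where the square of x_0 cancels together with Λ_N. -/
theorem x_two_mul_x_zero :
    P.x 2 * P.x 0 = P.x 0 * P.x 2 - (P.rho * qnum P.q 2) • (P.qH 2 * P.x 1) := by
  have h1 := P.eps_x_x 1
  rw [eps_simp (F := fun i j => P.x i * P.x j)] at h1
  have h2 := congrArg (· * P.x 1) P.sub_smul_x_one
  simp only [sub_mul, smul_mul_assoc, one_mul] at h2
  have h3 : P.x 0 * P.x 2 + (P.q - P.q⁻¹) • (P.x 1 * P.x 1) - P.x 2 * P.x 0 = P.Lam • P.x 1 := h1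
  rw [← h3] at h2
  linear_combination (norm := module) h2

/-- Each X⁺ q^{H/2} is x_1 up to a scalar. The factor √[2] in that scalar cancels against the one in
the spin 1 representation, so no square root survives. -/
theorem Lplus_eq : P.Lplus = ![![P.qH 2, 0, 0],
    ![((P.q - P.q⁻¹) * P.rho⁻¹ * P.q⁻¹) • P.x 0, 1, 0],
    ![((P.q - P.q⁻¹) ^ 2 * P.rho⁻¹ ^ 2 * (qnum P.q 2)⁻¹) • (P.qH (-2) * (P.x 0 * P.x 0)),
      ((P.q - P.q⁻¹) * P.rho⁻¹) • (P.qH (-2) * P.x 0), P.qH (-2)]] := by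
  have hq := P.q_ne
  have hr := P.rho_ne
  have hs := csqrt_sq (qnum P.q 2)
  have hs0 := csqrt_ne P.qnum_two_ne
  have h1 : qnum P.q 1 = 1 := by simp [qnum]
  rw [x_zero, ← rho]
  generalize hE : P.Xp * P.qH 1 = E
  funext i j
  fin_cases i <;> fin_cases j <;>
    simp [Lplus, hE, Finset.sum_range_succ, spinXm, pow_two,
      Matrix.mul_apply, wt, qfact, h1, qH_zero, Finset.prod_range_succ, Fin.sum_univ_three,
      Matrix.diagonal_apply, smul_smul, -mul_eq_mul_left_iff]
  all_goals
    congr 1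
    rw [← hs]
    field_simp

/-- The `L`-operators with a lowered index, `g_{im} L⁺^m_a`. -/
def Llow (i a : Fin 3) : P.Fun := ∑ m, g P.q i m • P.Lplus m a

theorem Lplus_eq_sum_Llow (i a : Fin 3) : P.Lplus i a = ∑ k, g P.q i k • P.Llow k a := by
  simp only [Llow, Finset.smul_sum, smul_smul]
  rw [Finset.sum_comm]
  simp only [← Finset.sum_smul, g_mul_g P.q_ne]
  simp

theorem Llow_eq : P.Llow = ![![-(P.q * (P.q - P.q⁻¹) ^ 2 * P.rho⁻¹ ^ 2 * (qnum P.q 2)⁻¹) •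
        (P.qH (-2) * (P.x 0 * P.x 0)),
      -(P.q * (P.q - P.q⁻¹) * P.rho⁻¹) • (P.qH (-2) * P.x 0), -P.q • P.qH (-2)],
    ![((P.q - P.q⁻¹) * P.rho⁻¹ * P.q⁻¹) • P.x 0, 1, 0], ![-P.q⁻¹ • P.qH 2, 0, 0]] := by
  funext i j
  fin_cases i <;> fin_cases j <;>
    simp [Llow, Lplus_eq, Fin.sum_univ_three, g, smul_smul, mul_assoc]

/-- The exchange relation of the coordinates and the `L`-operators. -/
theorem x_mul_Llow (i j a : Fin 3) :
    P.x i * P.Llow j a = ∑ k, ∑ l, Rhat P.q k l i j • (P.Llow k a * P.x l) := by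
  have hq := P.q_ne
  rw [Rhat_rel hq P.qnum_three_ne P.two_sq_ne fun k l => P.Llow k a * P.x l]
  exact exchange_of_relations (mul_inv_cancel₀ hq) (mul_inv_cancel₀ P.rho_ne)
    (mul_inv_cancel₀ P.qnum_two_ne) (qnum_two hq) (P.x 0) (P.x 1) (P.x 2) (P.qH 2) (P.qH (-2))
    P.qH_neg_two_mul_qH_two P.x_zero_mul_qH_two (P.x_one_mul_qH 2) P.x_two_mul_qH_two
    P.x_zero_mul_qH_neg_two (P.x_one_mul_qH (-2)) P.x_two_mul_qH_neg_two
    P.x_one_mul_x_zero P.x_two_mul_x_zero P.x P.Llow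
    (by funext k; fin_cases k <;> rfl) P.Llow_eq i j a

end Params

/-! ### Intertwiners, invertibility of R̂ and exchange in an abstract algebra -/

theorem sum_comm_pairs {M ι κ : Type*} [AddCommMonoid M] [Fintype ι] [Fintype κ]
    (f : ι → ι → κ → κ → M) :
    ∑ a, ∑ b, ∑ c, ∑ d, f a b c d = ∑ c, ∑ d, ∑ a, ∑ b, f a b c d := by
  have := Finset.sum_comm (s := (Finset.univ : Finset (ι × ι)))
    (t := (Finset.univ : Finset (κ × κ))) (f := fun u v => f u.1 u.2 v.1 v.2)
  simpa only [Fintype.sum_prod_type] using this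

/-- If a matrix `L` over a ring intertwines a tensor `T`, then so does its inverse `S`. -/
theorem intertwine_inv {A ι : Type*} [Ring A] [Algebra ℂ A] [Fintype ι] [DecidableEq ι]
    {T : ι → ι → ι → ℂ} {L S : ι → ι → A}
    (hS : ∀ i j, ∑ k, S i k * L k j = if i = j then 1 else 0)
    (hL : ∀ i j, ∑ k, L i k * S k j = if i = j then 1 else 0)
    (hT : ∀ i j c, ∑ b, ∑ a, T b a c • (L i a * L j b) = ∑ k, T j i k • L k c) (d e l : ι) :
    ∑ j, ∑ i, T j i l • (S d j * S e i) = ∑ c, T d e c • S c l := by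
  -- Multiplying the relation of L by two factors S from the left cancels the inner L first, then
  -- the outer one; this is why the order of the factors is reversed for S.
  have h1 (c : ι) : ∑ j, ∑ i, S d j * S e i * ∑ k, T j i k • L k c = T d e c • (1 : A) := by
    calc _ = ∑ j, ∑ i, ∑ b, ∑ a, T b a c • (S d j * (S e i * L i a * L j b)) := by
          simp only [← hT, Finset.mul_sum, mul_smul_comm, mul_assoc]
      _ = ∑ b, ∑ a, T b a c • ∑ j, S d j * ((∑ i, S e i * L i a) * L j b) := by
          rw [sum_comm_pairs]; simp only [Finset.mul_sum, Finset.sum_mul, Finset.smul_sum]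
      _ = _ := by simp [hS]
  -- The unit L S is inserted on the right to remove the remaining single L.
  calc _ = ∑ j, ∑ i, S d j * S e i * ∑ k, T j i k • ∑ c, L k c * S c l := by
        simp [hL]
    _ = ∑ c, (∑ j, ∑ i, S d j * S e i * ∑ k, T j i k • L k c) * S c l := by
        simp only [Finset.mul_sum, Finset.sum_mul, Finset.smul_sum, mul_smul_comm, smul_mul_assoc,
          mul_assoc]
        exact (Finset.sum_comm.trans (Finset.sum_congr rfl fun _ _ => Finset.sum_comm.trans
          (Finset.sum_congr rfl fun _ _ => Finset.sum_comm))).symm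
    _ = _ := by simp [h1]

/-- R̂ is injective: composed with the flip it is triangular, and its diagonal entries are powers of
q. -/
theorem eq_zero_of_sum_Rhat {M : Type*} [AddCommGroup M] [Module ℂ M] {q : ℂ} (hq : q ≠ 0)
    (h3 : qnum q 3 ≠ 0) (h2 : qnum (q ^ 2) 2 ≠ 0) {F : Fin 3 → Fin 3 → M}
    (h : ∀ i j, ∑ k, ∑ l, Rhat q k l i j • F k l = 0) (i j : Fin 3) : F i j = 0 := by
  have hp : q⁻¹ ^ 2 ≠ 0 := pow_ne_zero 2 (inv_ne_zero hq)
  have H i j := (Rhat_rel hq h3 h2 F i j).symm.trans (h i j)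
  have h00 : q ^ 2 • F 0 0 = 0 := H 0 0
  have h10 : F 1 0 = 0 := H 0 1
  have h20 : q⁻¹ ^ 2 • F 2 0 = 0 := H 0 2
  have h01 : F 0 1 + (q ^ 2 - q⁻¹ ^ 2) • F 1 0 = 0 := H 1 0
  have h11 : F 1 1 + (q - q⁻¹ ^ 3) • F 2 0 = 0 := H 1 1
  have h21 : F 2 1 = 0 := H 1 2
  have h02 : q⁻¹ ^ 2 • F 0 2 + (q - q⁻¹ ^ 3) • F 1 1 +
    ((q ^ 2 - q⁻¹ ^ 2) * (1 - q⁻¹ ^ 2)) • F 2 0 = 0 := H 2 0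
  have h12 : F 1 2 + (q ^ 2 - q⁻¹ ^ 2) • F 2 1 = 0 := H 2 1
  have h22 : q ^ 2 • F 2 2 = 0 := H 2 2
  replace h20 := (smul_eq_zero.1 h20).resolve_left hp
  simp only [h20, h10, h21, smul_zero, add_zero] at h01 h11 h12 h02
  simp only [h11, smul_zero, add_zero] at h02
  fin_cases i <;> fin_cases j
  exacts [(smul_eq_zero.1 h00).resolve_left (pow_ne_zero 2 hq), h01,
    (smul_eq_zero.1 h02).resolve_left hp, h10, h11, h12, h20, h21,
    (smul_eq_zero.1 h22).resolve_left (pow_ne_zero 2 hq)]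

/-- The product of two quantum vectors `X_i M_i` and `X_j N_j`, if `M` is exchanged with `X` by
`R̂` after the index of `M` has been lowered. -/
theorem mul_of_exchange {A : Type*} [Ring A] [Algebra ℂ A] {q p : ℂ} (h : q * p = 1)
    {X Y M : Fin 3 → A}
    (r00 : X 0 * Y 0 = q ^ 2 • (Y 0 * X 0))
    (r01 : X 0 * Y 1 = Y 1 * X 0)
    (r02 : X 0 * Y 2 = p ^ 2 • (Y 2 * X 0))
    (r10 : X 1 * Y 0 = Y 0 * X 1 + (q ^ 2 - p ^ 2) • (Y 1 * X 0))
    (r11 : X 1 * Y 1 = Y 1 * X 1 + (q - p ^ 3) • (Y 2 * X 0))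
    (r12 : X 1 * Y 2 = Y 2 * X 1)
    (r20 : X 2 * Y 0 = p ^ 2 • (Y 0 * X 2) + (q - p ^ 3) • (Y 1 * X 1) +
      ((q ^ 2 - p ^ 2) * (1 - p ^ 2)) • (Y 2 * X 0))
    (r21 : X 2 * Y 1 = Y 1 * X 2 + (q ^ 2 - p ^ 2) • (Y 2 * X 1))
    (r22 : X 2 * Y 2 = q ^ 2 • (Y 2 * X 2))
    (hM : M = ![-q • Y 2, Y 1, -p • Y 0]) (N : Fin 3 → A) :
    (∑ i, X i * M i) * ∑ j, X j * N j = ∑ i, ∑ j, (![![q ^ 2 • (X 0 * X 0), X 1 * X 0,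
        p ^ 2 • (X 2 * X 0)],
      ![X 0 * X 1 + (q ^ 2 - p ^ 2) • (X 1 * X 0), X 1 * X 1 + (q - p ^ 3) • (X 2 * X 0),
        X 2 * X 1],
      ![p ^ 2 • (X 0 * X 2) + (q - p ^ 3) • (X 1 * X 1) +
          ((q ^ 2 - p ^ 2) * (1 - p ^ 2)) • (X 2 * X 0),
        X 1 * X 2 + (q ^ 2 - p ^ 2) • (X 2 * X 1), q ^ 2 • (X 2 * X 2)]] :
          Fin 3 → Fin 3 → A) j i * (M i * N j) := by
  -- The exchange relations are triangular and can be solved for the products Y X. Substituting M,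
  -- which is Y with its index raised, turns the inverse coefficients back into those of R̂.
  have y00 : Y 0 * X 0 = p ^ 2 • (X 0 * Y 0) := by rw [r00]; match_scalars; grind
  have y20 : Y 2 * X 0 = q ^ 2 • (X 0 * Y 2) := by rw [r02]; match_scalars; grind
  have y01 : Y 0 * X 1 = X 1 * Y 0 - (q ^ 2 - p ^ 2) • (X 0 * Y 1) := by
    rw [r10, r01, add_sub_cancel_right]
  have y11 : Y 1 * X 1 = X 1 * Y 1 - (q ^ 3 - p) • (X 0 * Y 2) := by
    rw [r11, r02]; match_scalars <;> grind
  have y12 : Y 1 * X 2 = X 2 * Y 1 - (q ^ 2 - p ^ 2) • (X 1 * Y 2) := by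
    rw [r21, r12, add_sub_cancel_right]
  have y22 : Y 2 * X 2 = p ^ 2 • (X 2 * Y 2) := by rw [r22]; match_scalars; grind
  have y02 : Y 0 * X 2 = q ^ 2 • (X 2 * Y 0) - (q ^ 3 - p) • (X 1 * Y 1) +
      (q ^ 2 * (q ^ 2 - p ^ 2) * (1 - p ^ 2)) • (X 0 * Y 2) := by
    rw [r20, r11, r02]; match_scalars <;> grind
  have y10 := r01.symm
  have y21 := r12.symm
  clear r00 r01 r02 r10 r11 r12 r20 r21 r22
  have z00 := mul_mul_of_mul_eq y00
  have z01 := mul_mul_of_mul_eq y01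
  have z02 := mul_mul_of_mul_eq y02
  have z10 := mul_mul_of_mul_eq y10
  have z11 := mul_mul_of_mul_eq y11
  have z12 := mul_mul_of_mul_eq y12
  have z20 := mul_mul_of_mul_eq y20
  have z21 := mul_mul_of_mul_eq y21
  have z22 := mul_mul_of_mul_eq y22
  simp only [hM, Fin.sum_univ_three, Matrix.cons_val]
  simp only [mul_add, add_mul, mul_sub, sub_mul, mul_smul_comm, smul_mul_assoc, mul_assoc, z00,
    z01, z02, z10, z11, z12, z20, z21, z22]
  match_scalars <;> grind

/-- The `L`-operators intertwine the `q`-deformed structure constants and the metric. -/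
theorem intertwine_of_relations {A : Type*} [Ring A] [Algebra ℂ A] {q p s t t' : ℂ}
    (hq : q * p = 1) (ht : t * t' = 1) (htq : t = q + p) {a K K' : A}
    (hK : K' * K = 1) (hK' : K * K' = 1) (hKa : a * K = p ^ 2 • (K * a))
    (hKa' : a * K' = q ^ 2 • (K' * a)) {L : Fin 3 → Fin 3 → A}
    (hL : L = ![![K, 0, 0], ![((q - p) * s * p) • a, 1, 0],
      ![((q - p) ^ 2 * s ^ 2 * t') • (K' * (a * a)), ((q - p) * s) • (K' * a), K']])
    (hi : p = q⁻¹) (i j : Fin 3) :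
    (∀ c, ∑ b, ∑ a, eps q b a c • (L i a * L j b) = ∑ k, eps q j i k • L k c) ∧
      ∑ b, ∑ a, g q b a • (L i a * L j b) = g q j i • (1 : A) := by
  have hK2 := mul_mul_of_mul_eq hK
  have hK2' := mul_mul_of_mul_eq hK'
  have hKa2' := mul_mul_of_mul_eq hKa'
  subst hL
  refine ⟨fun c => ?_, ?_⟩
  · fin_cases i <;> fin_cases j <;> fin_cases c <;>
      simp [Fin.sum_univ_three, eps, ← hi, -neg_smul] <;>
      simp only [mul_assoc, mul_smul_comm, smul_mul_assoc, hK, hK', hKa, hKa', hK2, hK2', hKa2',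
        one_mul] <;>
      match_scalars <;> grind
  · fin_cases i <;> fin_cases j <;>
      simp [Fin.sum_univ_three, g, ← hi, -neg_smul] <;>
      simp only [mul_assoc, mul_smul_comm, smul_mul_assoc, hK, hK', hKa', hKa2'] <;>
      match_scalars <;> grind

/-! ### Quadratic relations of the `λ_a` -/

namespace Params
variable (P : Params)

theorem eps_Lplus_mul_Lplus (i j c : Fin 3) :
    ∑ b, ∑ a, eps P.q b a c • (P.Lplus i a * P.Lplus j b) = ∑ k, eps P.q j i k • P.Lplus k c :=
  (intertwine_of_relations (mul_inv_cancel₀ P.q_ne) (mul_inv_cancel₀ P.qnum_two_ne)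
    (qnum_two P.q_ne) P.qH_neg_two_mul_qH_two P.qH_two_mul_qH_neg_two P.x_zero_mul_qH_two
    P.x_zero_mul_qH_neg_two P.Lplus_eq rfl i j).1 c

theorem g_Lplus_mul_Lplus (i j : Fin 3) :
    ∑ b, ∑ a, g P.q b a • (P.Lplus i a * P.Lplus j b) = g P.q j i • (1 : P.Fun) :=
  (intertwine_of_relations (mul_inv_cancel₀ P.q_ne) (mul_inv_cancel₀ P.qnum_two_ne)
    (qnum_two P.q_ne) P.qH_neg_two_mul_qH_two P.qH_two_mul_qH_neg_two P.x_zero_mul_qH_two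
    P.x_zero_mul_qH_neg_two P.Lplus_eq rfl i j).2

/-- The 3 × 3 matrices over the functions form a finite-dimensional algebra, so the right inverse of
L⁺ is also a left inverse. -/
theorem SLplus_mul_Lplus (i j : Fin 3) :
    ∑ k, P.SLplus i k * P.Lplus k j = if i = j then 1 else 0 := by
  have h : (Matrix.of P.Lplus : Matrix (Fin 3) (Fin 3) P.Fun) * Matrix.of P.SLplus = 1 := by
    ext1 i j
    simpa [Matrix.mul_apply, Matrix.one_apply] using P.Lplus_mul_SLplus i j
  have h' := congrArg (fun M : Matrix (Fin 3) (Fin 3) P.Fun => M i j) (mul_eq_one_symm h)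
  simpa [Matrix.mul_apply, Matrix.one_apply] using h'

theorem eps_SLplus_mul_SLplus (d e l : Fin 3) :
    ∑ j, ∑ i, eps P.q j i l • (P.SLplus d j * P.SLplus e i) = ∑ c, eps P.q d e c • P.SLplus c l :=
  intertwine_inv P.SLplus_mul_Lplus P.Lplus_mul_SLplus P.eps_Lplus_mul_Lplus d e l

theorem Lam_smul_lam (a : Fin 3) : P.Lam • P.lam a = ∑ i, P.x i * P.Lplus i a := by
  rw [lam, smul_smul, mul_inv_cancel₀ P.Lam_ne, one_smul]

/-- In x_i L⁺^i_a x_j L⁺^j_b the inner L⁺^i_a is moved to the right of x_j by the exchange relation.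
-/
theorem lam_mul_lam (a b : Fin 3) : P.Lam ^ 2 • (P.lam a * P.lam b) =
    ∑ i, ∑ j, (∑ k, ∑ l, Rhat P.q k l j i • (P.x k * P.x l)) * (P.Lplus i a * P.Lplus j b) := by
  have R i j := (P.x_mul_Llow i j a).trans
    (Rhat_rel P.q_ne P.qnum_three_ne P.two_sq_ne (fun k l => P.Llow k a * P.x l) i j)
  have hM : (fun i => P.Lplus i a) =
      ![-P.q • P.Llow 2 a, P.Llow 1 a, -P.q⁻¹ • P.Llow 0 a] := by
    have := P.q_ne
    funext i
    fin_cases i <;> simp [Llow, g, Fin.sum_univ_three, smul_smul, this]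
  have H := mul_of_exchange (Y := fun i => P.Llow i a) (mul_inv_cancel₀ P.q_ne)
    (R 0 0) (R 0 1) (R 0 2) (R 1 0) (R 1 1) (R 1 2) (R 2 0) (R 2 1) (R 2 2) hM
    (fun j => P.Lplus j b)
  rw [pow_two, mul_smul, ← mul_smul_comm, ← smul_mul_assoc, Lam_smul_lam, Lam_smul_lam]
  simp only [Rhat_rel P.q_ne P.qnum_three_ne P.two_sq_ne (fun k l => P.x k * P.x l)]
  exact H

/-- Moves a contraction from the λ's onto the product of two L-operators, where the intertwining
property applies when T is g or ε. -/
theorem lam_mul_lam_contract (T : Fin 3 → Fin 3 → ℂ) :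
    P.Lam ^ 2 • ∑ a, ∑ b, T b a • (P.lam a * P.lam b) =
    ∑ i, ∑ j, (∑ k, ∑ l, Rhat P.q k l j i • (P.x k * P.x l)) *
      ∑ b, ∑ a, T b a • (P.Lplus i a * P.Lplus j b) := by
  have h : P.Lam ^ 2 • ∑ a, ∑ b, T b a • (P.lam a * P.lam b) =
      ∑ b, ∑ a, T b a • (P.Lam ^ 2 • (P.lam a * P.lam b)) := by
    rw [Finset.sum_comm]; simp only [Finset.smul_sum, smul_comm (P.Lam ^ 2)]
  rw [h]
  simp only [lam_mul_lam, Finset.smul_sum, Finset.mul_sum]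
  rw [sum_comm_pairs]
  simp only [mul_smul_comm]

/-- `ε` is an eigenvector of `R̂`. -/
theorem Rhat_eps (k l n : Fin 3) :
    ∑ i, ∑ j, eps P.q i j n * Rhat P.q k l i j = -(P.q⁻¹ ^ 2) * eps P.q k l n := by
  have h := mul_inv_cancel₀ P.q_ne
  simp only [Rhat_eq P.q_ne P.qnum_three_ne P.two_sq_ne, Fin.sum_univ_three, ← inv_pow]
  generalize hp : P.q⁻¹ = p at *
  fin_cases k <;> fin_cases l <;> fin_cases n <;> simp [eps, g, hp] <;> grind

/-- `g` is an eigenvector of `R̂`. -/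
theorem Rhat_g (k l : Fin 3) :
    ∑ i, ∑ j, g P.q i j * Rhat P.q k l i j = P.q⁻¹ ^ 4 * g P.q k l := by
  have h := mul_inv_cancel₀ P.q_ne
  simp only [Rhat_eq P.q_ne P.qnum_three_ne P.two_sq_ne, Fin.sum_univ_three, ← inv_pow]
  generalize hp : P.q⁻¹ = p at *
  fin_cases k <;> fin_cases l <;> simp [eps, g, hp] <;> grind

theorem sum_smul_sum_Rhat {M : Type*} [AddCommGroup M] [Module ℂ M] (q : ℂ)
    (T : Fin 3 → Fin 3 → ℂ) (F : Fin 3 → Fin 3 → M) :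
    ∑ i, ∑ j, T j i • ∑ k, ∑ l, Rhat q k l j i • F k l =
      ∑ k, ∑ l, (∑ i, ∑ j, T i j * Rhat q k l i j) • F k l := by
  simp only [Finset.smul_sum, smul_smul]
  rw [Finset.sum_comm, sum_comm_pairs]
  simp only [Finset.sum_smul]

/-- `λ_a λ_b g^{ba} = r² / (q⁴ Λ_N²)`. -/
theorem g_lam_lam : ∑ a, ∑ b, g P.q b a • (P.lam a * P.lam b) =
    ((P.r : ℂ) ^ 2 / (P.q ^ 4 * P.Lam ^ 2)) • (1 : P.Fun) := by
  have hL := P.Lam_ne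
  have hq := P.q_ne
  have h := P.lam_mul_lam_contract (g P.q)
  simp only [g_Lplus_mul_Lplus, mul_smul_comm, mul_one] at h
  rw [sum_smul_sum_Rhat P.q (g P.q) fun k l => P.x k * P.x l] at h
  simp only [Rhat_g, mul_smul, ← Finset.smul_sum, x_mul_x] at h
  rw [← eq_inv_smul_iff₀ (pow_ne_zero 2 hL)] at h
  rw [h]
  simp only [smul_smul]
  congr 1; field_simp

/-- `λ_a λ_b ε^{ba}_c = - q⁻² λ_c`. -/
theorem eps_lam_lam (c : Fin 3) : ∑ a, ∑ b, eps P.q b a c • (P.lam a * P.lam b) =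
    -(1 / P.q ^ 2) • P.lam c := by
  have hL := P.Lam_ne
  have hq := P.q_ne
  have h := P.lam_mul_lam_contract (fun b a => eps P.q b a c)
  simp only [eps_Lplus_mul_Lplus] at h
  have h2 (D : Fin 3 → Fin 3 → P.Fun) : ∑ i, ∑ j, D i j * ∑ n, eps P.q j i n • P.Lplus n c =
      ∑ n, (∑ i, ∑ j, eps P.q j i n • D i j) * P.Lplus n c := by
    simp only [Finset.mul_sum, Finset.sum_mul, mul_smul_comm, smul_mul_assoc]
    exact (Finset.sum_comm.trans (Finset.sum_congr rfl fun _ _ => Finset.sum_comm)).symm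
  rw [h2 fun i j => ∑ k, ∑ l, Rhat P.q k l j i • (P.x k * P.x l)] at h
  simp only [sum_smul_sum_Rhat P.q (fun i j => eps P.q i j _) fun k l => P.x k * P.x l] at h
  simp only [Rhat_eps, mul_smul, ← Finset.smul_sum, eps_x_x, smul_mul_assoc, ← Lam_smul_lam] at h
  rw [← eq_inv_smul_iff₀ (pow_ne_zero 2 hL)] at h
  rw [h]
  simp only [smul_smul]
  congr 1; field_simp

end Params

/-! ### Tensor identities of `ε` and cubic products -/

/-- `ε` with two raised indices. -/
theorem sum_g_mul_g_mul_eps {q : ℂ} (hq : q ≠ 0) (m j p : Fin 3) :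
    ∑ k, ∑ n, g q j k * g q m n * eps q k n p = ∑ l, eps q m j l * g q l p := by
  have h := mul_inv_cancel₀ hq
  simp only [Fin.sum_univ_three]
  generalize hp : q⁻¹ = p' at *
  fin_cases m <;> fin_cases j <;> fin_cases p <;> simp [eps, g, hp] <;> grind

/-- This is the normalization that makes P⁻ idempotent; it recovers `dualFrame` from the products of
the frame. -/
theorem eps_mul_eps {q : ℂ} (hq : q ≠ 0) (a l : Fin 3) :
    ∑ b, ∑ c, eps q b c a * eps q b c l = if a = l then qnum (q ^ 2) 2 else 0 := by
  have h := mul_inv_cancel₀ hq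
  rw [Params.qnum_two (pow_ne_zero 2 hq), ← inv_pow]
  simp only [Fin.sum_univ_three]
  generalize hp : q⁻¹ = p' at *
  fin_cases a <;> fin_cases l <;> simp [eps, hp] <;> grind

/-- If the products of three elements `θ^a` are governed by `ε`, then associativity makes all cubic
products multiples of a single element. -/
theorem cubic_of_eps {A : Type*} [Ring A] [Algebra ℂ A] {q : ℂ} (hq : q ≠ 0) {θ W : Fin 3 → A}
    (h : ∀ a b, θ a * θ b = ∑ l, eps q b a l • W l) (l c : Fin 3) :
    W l * θ c = g q c l • (W 1 * θ 1) := by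
  have hp := inv_ne_zero hq
  have E (a b c) : ∑ l, eps q b a l • (W l * θ c) = ∑ l, eps q c b l • (θ a * W l) := by
    have := mul_assoc (θ a) (θ b) (θ c)
    rw [h a b, h b c] at this
    simpa only [Finset.sum_mul, Finset.mul_sum, smul_mul_assoc, mul_smul_comm] using this
  simp only [Fin.sum_univ_three] at E
  -- Twelve instances of associativity determine all nine products. The pairs 012, 021 and 210, 201
  -- share the products θ_0 W_2 and θ_2 W_0 respectively, and eliminating these links W_0 θ_2 and
  -- W_2 θ_0 to W_1 θ_1.
  have e100 := E 1 0 0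
  have e002 := E 0 0 2
  have e011 := E 0 1 1
  have e122 := E 1 2 2
  have e220 := E 2 2 0
  have e211 := E 2 1 1
  have e020 := E 0 2 0
  have e202 := E 2 0 2
  have e012 := E 0 1 2
  have e021 := E 0 2 1
  have e210 := E 2 1 0
  have e201 := E 2 0 1
  clear E
  simp [eps, hq] at e100 e002 e011 e122 e220 e211 e020 e202 e012 e021 e210 e201
  rw [← e220] at e211 e202
  rw [e002] at e020
  rw [e002, smul_zero, neg_eq_zero, smul_eq_zero_iff_right hp] at e011
  rw [smul_zero, smul_eq_zero_iff_right hq] at e211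
  rw [neg_zero] at e202
  rw [neg_eq_zero] at e020
  have e02 : W 0 * θ 2 = -q⁻¹ • (W 1 * θ 1) := by
    rw [e012, neg_smul, ← smul_neg, e021, smul_smul, inv_mul_cancel₀ hq, one_smul]
  have e20 : W 2 * θ 0 = -q • (W 1 * θ 1) := by
    rw [e210, e201, neg_smul, smul_neg, neg_neg, smul_smul, mul_inv_cancel₀ hq, one_smul]
  fin_cases l <;> fin_cases c <;> simp [g, e100, e011, e02, e020, e202, e20, e211, e122]

/-! ### The frame and its commutation with functions -/

namespace Params
variable (P : Params)

/-- The basic one-forms `ξ^j = g^{jk} ξ_k`. -/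
def xiUp (j : Fin 3) : P.Form := ∑ k, g P.q j k • P.xi k

theorem theta_eq (a : Fin 3) :
    (P.theta a : P.Form) = P.Lam • ∑ j, P.fn (P.SLplus a j) * P.xiUp j := by
  simp only [xiUp, Finset.mul_sum, mul_smul_comm]; rfl

theorem xi_eq (i : Fin 3) : P.xi i = ∑ j, g P.q i j • P.xiUp j := by
  simp only [xiUp, Finset.smul_sum, smul_smul]
  rw [Finset.sum_comm]
  simp only [← Finset.sum_smul, g_mul_g P.q_ne]
  simp

/-- L⁺ S(L⁺) = 1 inverts the definition of the frame; both the spanning property and the formula for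
Θ come from this. -/
theorem sum_Lplus_mul_theta (i : Fin 3) :
    ∑ a, P.fn (P.Lplus i a) * (P.theta a : P.Form) = P.Lam • P.xiUp i := by
  calc _ = P.Lam • ∑ j, P.fn (∑ a, P.Lplus i a * P.SLplus a j) * P.xiUp j := by
        simp only [theta_eq, mul_smul_comm, Finset.mul_sum, map_sum, Finset.sum_mul, map_mul,
          Finset.smul_sum, mul_assoc]
        exact Finset.sum_comm
    _ = _ := by simp [Lplus_mul_SLplus, apply_ite P.fn]

theorem sum_Llow_mul_theta (i : Fin 3) :
    ∑ a, P.fn (P.Llow i a) * (P.theta a : P.Form) = P.Lam • P.xi i := by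
  rw [xi_eq]
  simp only [Finset.smul_sum, smul_comm P.Lam, ← sum_Lplus_mul_theta]
  rw [Finset.sum_comm]
  simp only [Llow, map_sum, map_smul, Finset.sum_mul, smul_mul_assoc]

theorem theta_mul_fn_x (a l : Fin 3) :
    (P.theta a : P.Form) * P.fn (P.x l) = P.fn (P.x l) * P.theta a := by
  let C (a l : Fin 3) : P.Form := P.theta a * P.fn (P.x l) - P.fn (P.x l) * P.theta a
  -- After summation over a, both terms of the commutator give Λ_N x_i ξ_j: the first by the
  -- relation of x with ξ, the second by the exchange relation of x with L⁺.
  have h1 (i j) : ∑ k, ∑ l, Rhat P.q k l i j • ∑ a, P.fn (P.Llow k a) * C a l = 0 := by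
    have e1 : ∑ k, ∑ l, Rhat P.q k l i j •
        ∑ a, P.fn (P.Llow k a) * ((P.theta a : P.Form) * P.fn (P.x l)) =
        P.Lam • (P.fn (P.x i) * P.xi j) := by
      simp only [← mul_assoc, ← Finset.sum_mul, sum_Llow_mul_theta, fn_x_mul_xi, Finset.smul_sum,
        smul_comm P.Lam, smul_mul_assoc]
    have e2 : ∑ k, ∑ l, Rhat P.q k l i j •
        ∑ a, P.fn (P.Llow k a) * (P.fn (P.x l) * (P.theta a : P.Form)) =
        P.Lam • (P.fn (P.x i) * P.xi j) := by
      rw [← mul_smul_comm, ← sum_Llow_mul_theta, Finset.mul_sum]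
      simp only [← mul_assoc, ← map_mul, x_mul_Llow, map_sum, map_smul, Finset.sum_mul,
        Finset.smul_sum, smul_mul_assoc]
      exact (Finset.sum_comm.trans (Finset.sum_congr rfl fun _ _ => Finset.sum_comm)).symm
    simp only [C, mul_sub, Finset.sum_sub_distrib, smul_sub, e1, e2, sub_self]
  have h2 := eq_zero_of_sum_Rhat P.q_ne P.qnum_three_ne P.two_sq_ne h1
  have h3 (i l) : ∑ a, P.fn (P.Lplus i a) * C a l = 0 := by
    simp only [Lplus_eq_sum_Llow, map_sum, map_smul, Finset.sum_mul, smul_mul_assoc]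
    rw [Finset.sum_comm]
    simp only [← Finset.smul_sum, h2, smul_zero, Finset.sum_const_zero]
  -- S(L⁺) L⁺ = 1 isolates each single commutator.
  have h4 : C a l = ∑ i, P.fn (P.SLplus a i) * ∑ b, P.fn (P.Lplus i b) * C b l := by
    simp only [Finset.mul_sum, ← mul_assoc, ← map_mul]
    rw [Finset.sum_comm]
    simp only [← Finset.sum_mul, ← map_sum, SLplus_mul_Lplus, apply_ite P.fn, map_one, map_zero,
      ite_mul, one_mul, zero_mul, Finset.sum_ite_eq, Finset.mem_univ, if_true]
  simp only [h3, mul_zero, Finset.sum_const_zero] at h4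
  exact sub_eq_zero.1 h4

/-- The frame commutes with all functions. -/
theorem theta_mul_fn (a : Fin 3) (f : P.Fun) :
    (P.theta a : P.Form) * P.fn f = P.fn f * P.theta a := by
  have hf : f ∈ Algebra.adjoin ℂ (Set.range P.x) := by rw [P.adjoin_x]; trivial
  induction hf using Algebra.adjoin_induction with
  | mem f hf => obtain ⟨i, rfl⟩ := hf; exact P.theta_mul_fn_x a i
  | algebraMap c => rw [AlgHom.commutes]; exact (Algebra.commutes c _).symm
  | add f h _ _ hf hh => rw [map_add, mul_add, add_mul, hf, hh]
  | mul f h _ _ hf hh => rw [map_mul, ← mul_assoc, hf, mul_assoc, hh, mul_assoc]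

theorem Theta_eq_sum_xiUp : P.Theta = ∑ i, P.fn (P.x i) * P.xiUp i := by
  simp only [Theta, xiUp, Finset.mul_sum, mul_smul_comm]

/-- `Θ = λ_a θ^a`. -/
theorem Theta_eq : P.Theta = ∑ a, P.fn (P.lam a) * (P.theta a : P.Form) := by
  rw [Theta_eq_sum_xiUp]
  have h (i) : P.xiUp i = P.Lam⁻¹ • ∑ a, P.fn (P.Lplus i a) * (P.theta a : P.Form) := by
    rw [sum_Lplus_mul_theta, smul_smul, inv_mul_cancel₀ P.Lam_ne, one_smul]
  simp only [h, lam, map_smul, map_sum, map_mul, Finset.sum_mul, Finset.mul_sum, smul_mul_assoc,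
    mul_smul_comm, ← Finset.smul_sum, mul_assoc]
  rw [Finset.sum_comm]

theorem dFun_eq (f : P.Fun) :
    P.dFun f = ∑ a, P.fn (P.lam a * f - f * P.lam a) * (P.theta a : P.Form) := by
  simp only [dFun, Theta_eq, Finset.sum_mul, Finset.mul_sum, mul_assoc, theta_mul_fn,
    ← Finset.sum_sub_distrib, map_sub, map_mul, sub_mul]

/-! ### Independence of the frame -/

/-- The algebra map `f ↦ diag (f, f)`, `ξ_i ↦ [[0, Λ_N⁻¹ g_{im} L⁺^m_a], [0, 0]]`, which reads off
the component of a one-form along `θ^a`. -/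
def frameCoord (a : Fin 3) : P.Form →ₐ[ℂ] Matrix (Fin 2) (Fin 2) P.Fun :=
  RingQuot.liftAlgHom ℂ ⟨FreeAlgebra.lift ℂ (Sum.elim (fun f => !![f, 0; 0, f])
    fun i => !![0, P.Lam⁻¹ • P.Llow i a; 0, 0]), fun u v h => by
    cases h with
    | one => simpa using Matrix.one_fin_two.symm
    | add f h => simp
    | smul c f => simp
    | mul f h => simp
    | braid i j =>
      simp only [map_mul, map_sum, map_smul, FreeAlgebra.lift_ι_apply, Sum.elim_inl, Sum.elim_inr]
      ext1 s t
      -- The only non-trivial matrix entry of the braid relation is the exchange relation.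
      have h1 := P.x_mul_Llow i j a
      fin_cases s <;> fin_cases t <;>
        simp [Matrix.sum_apply, h1, Finset.smul_sum, smul_comm P.Lam⁻¹]
    -- Both sides vanish, since strictly upper triangular 2 × 2 matrices multiply to zero.
    | antisymm i j =>
      simp only [map_mul, map_sum, map_smul, FreeAlgebra.lift_ι_apply, Sum.elim_inr]
      ext1 s t
      fin_cases s <;> fin_cases t <;> simp⟩

theorem frameCoord_fn (a : Fin 3) (f : P.Fun) : P.frameCoord a (P.fn f) = !![f, 0; 0, f] :=
  (RingQuot.liftAlgHom_mkAlgHom_apply ..).trans (by simp)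

theorem frameCoord_xi (a i : Fin 3) :
    P.frameCoord a (P.xi i) = !![0, P.Lam⁻¹ • P.Llow i a; 0, 0] :=
  (RingQuot.liftAlgHom_mkAlgHom_apply ..).trans (by simp)

/-- The factors Λ_N and Λ_N⁻¹ cancel and S(L⁺) L⁺ = 1 leaves the Kronecker delta. -/
theorem frameCoord_fn_mul_theta (a b : Fin 3) (f : P.Fun) :
    P.frameCoord a (P.fn f * P.theta b) 0 1 = if a = b then f else 0 := by
  have hL := P.Lam_ne
  have h : P.frameCoord a (P.theta b) 0 1 = if a = b then 1 else 0 := by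
    change P.frameCoord a (P.Lam • ∑ j, ∑ k, g P.q j k • (P.fn (P.SLplus b j) * P.xi k)) 0 1 = _
    simp only [map_smul, map_sum, map_mul, frameCoord_fn, frameCoord_xi, Matrix.smul_apply,
      Matrix.sum_apply]
    have e2 := P.SLplus_mul_Lplus b a
    simp only [Lplus_eq_sum_Llow, Finset.mul_sum, mul_smul_comm] at e2
    simp [smul_comm _ P.Lam⁻¹, ← Finset.smul_sum, inv_smul_smul₀ hL, e2, eq_comm (a := a)]
  rw [map_mul, frameCoord_fn, Matrix.mul_apply, Fin.sum_univ_two]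
  simp [h]

theorem existsUnique_coord {α : P.Form} (hα : α ∈ P.oneForms) :
    ∃! c : Fin 3 → P.Fun, α = ∑ a, P.fn (c a) * (P.theta a : P.Form) := by
  have hex : ∃ c : Fin 3 → P.Fun, α = ∑ a, P.fn (c a) * (P.theta a : P.Form) := by
    induction hα using Submodule.span_induction with
    | mem α h =>
      obtain ⟨⟨i, f⟩, rfl⟩ := h
      -- The coefficients come from ξ_i = Λ_N⁻¹ g_{im} L⁺^m_a θ^a, once f has been moved to the left
      -- of θ^a.
      refine ⟨fun a => P.Lam⁻¹ • (P.Llow i a * f), ?_⟩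
      have h : P.xi i = P.Lam⁻¹ • ∑ a, P.fn (P.Llow i a) * (P.theta a : P.Form) := by
        rw [sum_Llow_mul_theta, smul_smul, inv_mul_cancel₀ P.Lam_ne, one_smul]
      simp only [h, smul_mul_assoc, Finset.sum_mul, mul_assoc, theta_mul_fn, map_smul, map_mul,
        ← Finset.smul_sum]
    | zero => exact ⟨0, by simp⟩
    | add α β _ _ hα hβ =>
      obtain ⟨c, rfl⟩ := hα
      obtain ⟨d, rfl⟩ := hβ
      exact ⟨c + d, by simp [add_mul, Finset.sum_add_distrib]⟩
    | smul z α _ hα =>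
      obtain ⟨c, rfl⟩ := hα
      exact ⟨z • c, by simp [Finset.smul_sum]⟩
  obtain ⟨c, hc⟩ := hex
  refine ⟨c, hc, fun d hd => ?_⟩
  funext a
  have h (e : Fin 3 → P.Fun) (he : α = ∑ b, P.fn (e b) * (P.theta b : P.Form)) :
      P.frameCoord a α 0 1 = e a := by
    rw [he, map_sum, Matrix.sum_apply]
    simp only [frameCoord_fn_mul_theta]
    simp
  exact (h d hd).symm.trans (h c hc)

end Params
-- Two-forms and products of two frame elements
namespace Params
variable (P : Params)

/-- The contraction with g is multiplied by -q² · q⁻⁴ = -q⁻² under the quadratic relation, and this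
factor is not 1 because [2]_q ≠ 0. -/
theorem g_xi_xi : -P.q • (P.xi 0 * P.xi 2) + P.xi 1 * P.xi 1 - P.q⁻¹ • (P.xi 2 * P.xi 0) = 0 := by
  have h := mul_inv_cancel₀ P.q_ne
  have R : ∀ i j, P.xi i * P.xi j = _ := fun i j => (P.xi_mul_xi i j).trans
    (congrArg _ (Rhat_rel P.q_ne P.qnum_three_ne P.two_sq_ne (fun k l => P.xi k * P.xi l) i j))
  have r20 : P.xi 0 * P.xi 2 = -(P.q ^ 2) • P.q⁻¹ ^ 2 • (P.xi 2 * P.xi 0) := R 0 2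
  have r11 : P.xi 1 * P.xi 1 = -(P.q ^ 2) • (P.xi 1 * P.xi 1 +
    (P.q - P.q⁻¹ ^ 3) • (P.xi 2 * P.xi 0)) := R 1 1
  have h2 : P.q ^ 2 + 1 ≠ 0 := by
    have := P.qnum_two_ne
    rw [qnum_two P.q_ne] at this
    intro h; apply this; have := P.q_ne; field_simp; simpa using h
  refine (smul_eq_zero.1 (?_ : (P.q ^ 2 + 1) • _ = (0 : P.Form))).resolve_left h2
  have e : (P.q ^ 2 + 1) • (P.xi 1 * P.xi 1) = -(P.q ^ 2 * (P.q - P.q⁻¹ ^ 3)) • (P.xi 2 * P.xi 0) := by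
    linear_combination (norm := module) r11
  rw [smul_sub, smul_add, e, r20]
  generalize P.q⁻¹ = p at *
  match_scalars
  grind

/-- Two-forms are spanned by `ε_p^{kl} ξ_k ξ_l`. -/
theorem xi_mul_xi_eq (i j : Fin 3) :
    P.xi i * P.xi j = ∑ p, eps P.q i j p • (qnum (P.q ^ 2) 2)⁻¹ • P.epsXi p := by
  have h := P.xi_mul_xi i j
  rw [Rhat_sum P.q_ne P.qnum_three_ne P.two_sq_ne i j fun k l => P.xi k * P.xi l, g_xi_xi,
    smul_zero, add_zero] at h
  -- Without the P⁰ term, the quadratic relation determines ξ_i ξ_j up to the factor q⁴ + 1 = q²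
  -- [2]_{q²}, which is non-zero.
  have e : P.q ^ 2 • ∑ p, eps P.q i j p • P.epsXi p = (P.q ^ 4 + 1) • (P.xi i * P.xi j) := by
    simp only [Fin.sum_univ_three, epsXi_eq, Matrix.cons_val]
    linear_combination (norm := module) -h
  have hq := P.q_ne
  have h2 := P.two_sq_ne
  have e2 : qnum (P.q ^ 2) 2 = (P.q ^ 2)⁻¹ * (P.q ^ 4 + 1) := by
    rw [qnum_two (pow_ne_zero 2 hq)]; field_simp
  have e3 : qnum (P.q ^ 2) 2 • (P.xi i * P.xi j) = ∑ p, eps P.q i j p • P.epsXi p := by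
    rw [e2, mul_smul, ← e, inv_smul_smul₀ (pow_ne_zero 2 hq)]
  simp only [smul_comm _ (qnum (P.q ^ 2) 2)⁻¹, ← Finset.smul_sum]
  rw [← e3, inv_smul_smul₀ h2]

/-- The two-forms `Λ_N² S(L⁺^c_l) g^{lp} ε_p^{ij} ξ_i ξ_j / [2]_{q²}`, which are up to a factor the
Hodge duals of the frame. -/
def dualFrame (c : Fin 3) : P.Form :=
  P.Lam ^ 2 • ∑ l, ∑ p, g P.q l p • (P.fn (P.SLplus c l) * ((qnum (P.q ^ 2) 2)⁻¹ • P.epsXi p))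

/-- Raising both indices of ε by g reverses their order (`sum_g_mul_g_mul_eps`); this is the source
of the reversed indices in the relations of the frame. -/
theorem xiUp_mul_xiUp (j m : Fin 3) : P.xiUp j * P.xiUp m =
    ∑ l, eps P.q m j l • ∑ p, g P.q l p • (qnum (P.q ^ 2) 2)⁻¹ • P.epsXi p := by
  -- The rescaled two-forms are made opaque so that simplification does not merge their scalar with
  -- the tensor coefficients.
  obtain ⟨Z, hZ⟩ : ∃ Z : Fin 3 → P.Form, ∀ p, (qnum (P.q ^ 2) 2)⁻¹ • P.epsXi p = Z p :=
    ⟨_, fun _ => rfl⟩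
  have hX := P.xi_mul_xi_eq
  simp only [hZ] at hX ⊢
  have h1 : P.xiUp j * P.xiUp m = ∑ p, (∑ k, ∑ n, g P.q j k * g P.q m n * eps P.q k n p) • Z p := by
    rw [xiUp, xiUp, Finset.sum_mul_sum]
    simp only [smul_mul_smul_comm, hX, Finset.smul_sum, smul_smul, Finset.sum_smul]
    exact (Finset.sum_comm.trans (Finset.sum_congr rfl fun _ _ => Finset.sum_comm)).symm
  rw [h1]
  simp only [sum_g_mul_g_mul_eps P.q_ne, Finset.sum_smul, mul_smul, Finset.smul_sum]
  exact Finset.sum_comm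

/-- As θ^a commutes with the functions in θ^b, the product is S^b_m S^a_j ξ^j ξ^m up to Λ_N².
Expanding ξ^j ξ^m by ε^{mj}_l and moving ε through the two factors S leaves the single factor in
`dualFrame`. -/
theorem theta_mul_theta (a b : Fin 3) :
    (P.theta a : P.Form) * P.theta b = ∑ c, eps P.q b a c • P.dualFrame c := by
  calc (P.theta a : P.Form) * P.theta b
      = P.Lam • ∑ m, P.fn (P.SLplus b m) * ((P.theta a : P.Form) * P.xiUp m) := by
        rw [P.theta_eq b]
        simp only [mul_smul_comm, Finset.mul_sum, ← mul_assoc, theta_mul_fn]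
    _ = P.Lam ^ 2 • ∑ m, ∑ j, P.fn (P.SLplus b m * P.SLplus a j) * (P.xiUp j * P.xiUp m) := by
        simp only [theta_eq, pow_two, mul_smul, mul_smul_comm, smul_mul_assoc, Finset.mul_sum,
          Finset.sum_mul, map_mul, mul_assoc, Finset.smul_sum]
    _ = P.Lam ^ 2 • ∑ l, P.fn (∑ m, ∑ j, eps P.q m j l • (P.SLplus b m * P.SLplus a j)) *
          ∑ p, g P.q l p • (qnum (P.q ^ 2) 2)⁻¹ • P.epsXi p := by
        congr 1
        simp only [xiUp_mul_xiUp, map_sum, map_smul, Finset.sum_mul, smul_mul_assoc,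
          Finset.mul_sum (s := Finset.univ) (f := fun l => eps _ _ _ l • _), mul_smul_comm]
        exact (Finset.sum_comm.trans (Finset.sum_congr rfl fun _ _ => Finset.sum_comm)).symm
    _ = _ := by
        simp only [eps_SLplus_mul_SLplus, dualFrame, map_sum, map_smul, Finset.sum_mul,
          smul_mul_assoc, Finset.mul_sum, mul_smul_comm, Finset.smul_sum]
        refine Eq.trans ?_ (Finset.sum_comm.trans
          (Finset.sum_congr rfl fun _ _ => Finset.sum_comm)).symm
        refine Finset.sum_congr rfl fun l _ => Finset.sum_congr rfl fun p _ =>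
          Finset.sum_congr rfl fun c _ => ?_
        module

/-! ### The Hodge star -/

theorem starAux_fn (f : P.Fun) : P.starAux (P.fn f) = !![P.fn f, 0; 0, P.fn f] :=
  (P.starAux_toForm _).trans (P.starAux₀_inl f)

theorem starAux_xi (i : Fin 3) : P.starAux (P.xi i) = !![-P.xi i, P.starXi i; 0, P.xi i] :=
  (P.starAux_toForm _).trans (P.starAux₀_inr i)

/-- By uniqueness the star is the off-diagonal entry of the multiplicative map `starAux`, which
makes it left linear over the functions too and so computable on the frame. -/
theorem hodgeStar_apply (α : P.oneForms) : P.hodgeStar α = P.starAux α 0 1 := by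
  let S : P.oneForms →ₗ[ℂ] P.Form :=
    ⟨⟨fun α => P.starAux α 0 1, fun α β => by simp⟩, fun c α => by simp⟩
  have h := P.existsUnique_star.unique P.hodgeStar_xi_fn (y₂ := S) fun i f => by
    change P.starAux (P.xi i * P.fn f) 0 1 = _
    rw [map_mul, starAux_xi, starAux_fn]; simp
  rw [h]; rfl

theorem hodgeStar_theta_eq (a : Fin 3) :
    P.hodgeStar (P.theta a) = -(P.q ^ 2)⁻¹ • P.dualFrame a := by
  rw [hodgeStar_apply]
  change P.starAux (P.Lam • ∑ j, ∑ k, g P.q j k • (P.fn (P.SLplus a j) * P.xi k)) 0 1 = _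
  simp only [map_smul, map_sum, map_mul, starAux_fn, starAux_xi, Matrix.smul_apply,
    Matrix.sum_apply]
  simp only [dualFrame, Matrix.mul_apply, Fin.sum_univ_two, Finset.smul_sum]
  refine Finset.sum_congr rfl fun j _ => Finset.sum_congr rfl fun k _ => ?_
  simp [starXi_eq, smul_smul]
  congr 1
  ring

theorem eps_theta_theta (a : Fin 3) :
    ∑ b, ∑ c, eps P.q b c a • ((P.theta c : P.Form) * P.theta b) =
      qnum (P.q ^ 2) 2 • P.dualFrame a := by
  simp only [theta_mul_theta, Finset.smul_sum, smul_smul]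
  have h : ∑ b, ∑ c, ∑ l, (eps P.q b c a * eps P.q b c l) • P.dualFrame l =
      ∑ l, (∑ b, ∑ c, eps P.q b c a * eps P.q b c l) • P.dualFrame l := by
    simp only [Finset.sum_smul]
    exact (Finset.sum_comm.trans (Finset.sum_congr rfl fun _ _ => Finset.sum_comm)).symm
  rw [h]
  simp [eps_mul_eps P.q_ne]

theorem hodgeStar_theta (a : Fin 3) : P.hodgeStar (P.theta a) =
    -(1 / (P.q ^ 2 * qnum (P.q ^ 2) 2)) •
      ∑ b, ∑ c, eps P.q b c a • ((P.theta c : P.Form) * P.theta b) := by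
  have h2 := P.two_sq_ne
  rw [hodgeStar_theta_eq, eps_theta_theta, smul_smul]
  congr 1; field_simp

theorem dOne_theta (a : Fin 3) : P.dOne (P.theta a) =
    ∑ b, P.fn (P.lam b) *
        ((P.theta a : P.Form) * P.theta b + (P.theta b : P.Form) * P.theta a) +
      (1 / (P.q ^ 2 * qnum (P.q ^ 2) 2)) •
        ∑ b, ∑ c, eps P.q b c a • ((P.theta c : P.Form) * P.theta b) := by
  rw [dOne, hodgeStar_theta, neg_smul, sub_neg_eq_add, Theta_eq]
  congr 1
  simp only [Finset.sum_mul, Finset.mul_sum, mul_add, Finset.sum_add_distrib, mul_assoc]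
  rw [add_comm]
  congr 1
  simp only [← mul_assoc, theta_mul_fn]

/-! ### Braiding of the frame and its cubic products -/

theorem theta_mul_theta_braid (a b : Fin 3) : (P.theta a : P.Form) * P.theta b =
    -(P.q ^ 2) • ∑ c, ∑ d, Rhat P.q b a c d • ((P.theta d : P.Form) * P.theta c) := by
  have hq := P.q_ne
  simp only [theta_mul_theta, Finset.smul_sum (s := Finset.univ) (f := fun l => eps _ _ _ l • _),
    smul_smul]
  have h : ∑ c, ∑ d, ∑ l, (Rhat P.q b a c d * eps P.q c d l) • P.dualFrame l =
      ∑ l, (∑ c, ∑ d, eps P.q c d l * Rhat P.q b a c d) • P.dualFrame l := by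
    simp only [Finset.sum_smul, mul_comm]
    exact (Finset.sum_comm.trans (Finset.sum_congr rfl fun _ _ => Finset.sum_comm)).symm
  rw [h]
  -- The eigenvalue -q⁻² of R̂ on ε is cancelled by the prefactor -q².
  simp only [Rhat_eps, Finset.smul_sum, smul_smul]
  refine Finset.sum_congr rfl fun l _ => ?_
  congr 1; field_simp

theorem theta_mul_theta_mul_theta (a b c : Fin 3) :
    (P.theta a : P.Form) * P.theta b * P.theta c =
      epsUp P.q c b a • (P.dualFrame 1 * P.theta 1) := by
  rw [theta_mul_theta, Finset.sum_mul, epsUp, Finset.sum_smul]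
  refine Finset.sum_congr rfl fun l _ => ?_
  rw [smul_mul_assoc, cubic_of_eps P.q_ne P.theta_mul_theta, smul_smul, mul_comm]

/-- The first two factors contract through ε to -q⁻² λ_n, and what is left is the g-contraction of
two λ's. -/
theorem epsUp_lam_lam_lam :
    ∑ a, ∑ b, ∑ c, epsUp P.q c b a • (P.lam a * P.lam b * P.lam c) =
      -((P.r : ℂ) ^ 2 / (P.q ^ 6 * P.Lam ^ 2)) • (1 : P.Fun) := by
  have h : ∑ a, ∑ b, ∑ c, epsUp P.q c b a • (P.lam a * P.lam b * P.lam c) =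
      ∑ c, ∑ n, g P.q c n • ((∑ a, ∑ b, eps P.q b a n • (P.lam a * P.lam b)) * P.lam c) := by
    simp only [epsUp, Finset.sum_smul, Finset.sum_mul, Finset.smul_sum, smul_mul_assoc, mul_smul]
    exact sum_comm_pairs _
  rw [h]
  simp only [eps_lam_lam, smul_mul_assoc, smul_comm _ (-(1 / P.q ^ 2)), ← Finset.smul_sum]
  rw [Finset.sum_comm, g_lam_lam, smul_smul]
  congr 1; have := P.q_ne; have := P.Lam_ne; field_simp

/-- All functions move to the left of the frame, where they meet the tensor of the cubic products.
The resulting scalar is non-zero because r ≠ 0, so Θ³ can replace the common three-form. -/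
theorem Theta_pow_three : P.Theta ^ 3 =
    -((P.r : ℂ) ^ 2 / (P.q ^ 6 * P.Lam ^ 2)) • (P.dualFrame 1 * P.theta 1) := by
  have h : P.Theta ^ 3 = ∑ a, ∑ b, ∑ c, P.fn (P.lam a * P.lam b * P.lam c) *
      ((P.theta a : P.Form) * P.theta b * P.theta c) := by
    have hs (a : Fin 3) (f : P.Fun) := mul_mul_of_mul_eq (P.theta_mul_fn a f)
    rw [pow_three', Theta_eq, Finset.sum_mul_sum, Finset.sum_mul]
    refine Finset.sum_congr rfl fun a _ => ?_
    rw [Finset.sum_mul_sum]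
    refine Finset.sum_congr rfl fun b _ => Finset.sum_congr rfl fun c _ => ?_
    simp only [map_mul, mul_assoc, hs]
  have h2 (V : P.Form) : ∑ a, ∑ b, ∑ c, epsUp P.q c b a • (P.fn (P.lam a * P.lam b * P.lam c) * V) =
      P.fn (∑ a, ∑ b, ∑ c, epsUp P.q c b a • (P.lam a * P.lam b * P.lam c)) * V := by
    simp only [map_sum, map_smul, Finset.sum_mul, smul_mul_assoc]
  rw [h]
  simp only [theta_mul_theta_mul_theta, mul_smul_comm]
  rw [h2, epsUp_lam_lam_lam, map_smul, map_one, smul_mul_assoc, one_mul]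

theorem theta_cubic (a b c : Fin 3) : (P.theta a : P.Form) * P.theta b * P.theta c =
    -(P.Lam ^ 2 * P.q ^ 6 / (P.r : ℂ) ^ 2 * epsUp P.q c b a) • P.Theta ^ 3 := by
  have := P.q_ne
  have := P.Lam_ne
  have : (P.r : ℂ) ≠ 0 := by exact_mod_cast P.r_ne
  rw [Theta_pow_three, theta_mul_theta_mul_theta, smul_smul]
  congr 1; field_simp

end Params
end QFuzzySphere
end

theorem mainTheorem8 (P : QFuzzySphere.Params) :
    -- the frame commutes with all functions
    (∀ (a : Fin 3) (f : P.Fun), (P.theta a : P.Form) * P.fn f - P.fn f * P.theta a = 0) ∧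
    -- it is a basis of the one-forms over the functions
    (∀ α ∈ P.oneForms, ∃! c : Fin 3 → P.Fun, α = ∑ a, P.fn (c a) * (P.theta a : P.Form)) ∧
    -- the `λ_a` are dual to it
    (∀ f : P.Fun,
      P.dFun f = ∑ a, P.fn (P.lam a * f - f * P.lam a) * (P.theta a : P.Form)) ∧
    (P.Theta = ∑ a, P.fn (P.lam a) * (P.theta a : P.Form)) ∧
    -- the relations of the `λ_a`
    (∑ a, ∑ b, QFuzzySphere.g P.q b a • (P.lam a * P.lam b) =
      ((P.r : ℂ) ^ 2 / (P.q ^ 4 * P.Lam ^ 2)) • (1 : P.Fun)) ∧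
    (∀ c : Fin 3, ∑ a, ∑ b, QFuzzySphere.eps P.q b a c • (P.lam a * P.lam b) =
      -(1 / P.q ^ 2) • P.lam c) ∧
    -- the relations of the `θ^a`
    (∀ a b : Fin 3, (P.theta a : P.Form) * P.theta b =
      -(P.q ^ 2) • ∑ c, ∑ d, QFuzzySphere.Rhat P.q b a c d •
        ((P.theta d : P.Form) * P.theta c)) ∧
    (∀ a : Fin 3, P.dOne (P.theta a) =
      ∑ b, P.fn (P.lam b) *
        ((P.theta a : P.Form) * P.theta b + (P.theta b : P.Form) * P.theta a) +
      (1 / (P.q ^ 2 * QFuzzySphere.qnum (P.q ^ 2) 2)) •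
        ∑ b, ∑ c, QFuzzySphere.eps P.q b c a • ((P.theta c : P.Form) * P.theta b)) ∧
    (∀ a : Fin 3, P.hodgeStar (P.theta a) =
      -(1 / (P.q ^ 2 * QFuzzySphere.qnum (P.q ^ 2) 2)) •
        ∑ b, ∑ c, QFuzzySphere.eps P.q b c a • ((P.theta c : P.Form) * P.theta b)) ∧
    (∀ a b c : Fin 3, (P.theta a : P.Form) * P.theta b * P.theta c =
      -(P.Lam ^ 2 * P.q ^ 6 / (P.r : ℂ) ^ 2 * QFuzzySphere.epsUp P.q c b a) • P.Theta ^ 3) := by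
  exact ⟨fun a f => sub_eq_zero.2 (P.theta_mul_fn a f), fun _ hα => P.existsUnique_coord hα,
    P.dFun_eq, P.Theta_eq, P.g_lam_lam, P.eps_lam_lam, P.theta_mul_theta_braid, P.dOne_theta,
    P.hodgeStar_theta, P.theta_cubic⟩
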